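/- A digraph has no loops and no repeated arcs, but may contain both arcs $uv$ and $vu$; its base graph is obtained by forgetting orientations, and $\delta^+$ denotes its minimum out-degree. For an integer $r\ge 3$ and a digraph $R$, let $\mathcal K_{r,r-2}(R)$ be the set of all (not necessarily induced) subdigraphs $K$ of $R$ on $r$ vertices with complete base graph and $\delta^+(K)\ge r-2$. A perfect fractional $(r,r-2)$-tiling of $R$ is a function $\omega:\mathcal K_{r,r-2}(R)\to[0,1]$ such that $\sum_{K\in\mathcal K_{r,r-2}(R),\,v\in V(K)}\omega(K)=1$ for every vertex $v$ of $R$. For an edge-coloured graph $G$ (with an arbitrary, not necessarily proper, edge-colouring), the minimum colour degree $\delta^c(G)$ is the minimum over all vertices $v$ of the number of distinct colours on edges incident to $v$; a subgraph is rainbow if its edges have pairwise distinct colours; and a rainbow-$K_r$-tiling is a collection of vertex-disjoint rainbow copies of $K_r$ in $G$ (colours may repeat between different copies). \textbf{Lemma.} For every integer $r\ge 3$ and every $\gamma>0$ there is $\varepsilon_0>0$ such that for every $0<\varepsilon\le\varepsilon_0$ there is $t_0$ such that for every integer $t\ge t_0$ there is $n_0$ such that the following holds for every integer $n\ge n_0$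 and every real $\delta$. Suppose that every digraph $R$ on $t$ vertices with $\delta^+(R)\ge\delta t$ contains a perfect fractional $(r,r-2)$-tiling. Then every edge-coloured graph $G$ on $n$ vertices with $\delta^c(G)\ge(\delta+3\gamma)n$ contains a rainbow-$K_r$-tiling covering all but at most $3\varepsilon^{1/2}n$ vertices of $G$. -/

import Mathlib

section AlmostTiling

/-- A digraph has no loops (antiparallel pairs of arcs are allowed). -/
def DigraphLoopless {V : Type*} (D : Digraph V) : Prop :=
  ∀ v, ¬ D.Adj v v

/-- The out-degree of a vertex in a (finite) digraph. -/
noncomputable def outDeg {V : Type*} (D : Digraph V) (v : V) : ℕ :=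
  {w | D.Adj v w}.ncard

/-- The minimum out-degree of a digraph. -/
noncomputable def minOutDeg {V : Type*} (D : Digraph V) : ℕ :=
  ⨅ v, outDeg D v

/-- `K = (S, A)`, with vertex set `S` and arc set `A`, is a copy in `D` of a member of the family of
digraphs on `r` vertices with minimum out-degree at least `r - 2` and complete base graph.
Copies are subdigraphs of `D`, not necessarily induced. -/
structure IsTileCopy {V : Type*} (r : ℕ) (D : Digraph V) (K : Finset V × Finset (V × V)) :
    Prop where
  card_verts : K.1.card = r
  arcs_mem : ∀ a ∈ K.2, a.1 ∈ K.1 ∧ a.2 ∈ K.1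
  arcs_adj : ∀ a ∈ K.2, D.Adj a.1 a.2
  base_complete : ∀ u ∈ K.1, ∀ v ∈ K.1, u ≠ v → (u, v) ∈ K.2 ∨ (v, u) ∈ K.2
  le_outDeg : ∀ u ∈ K.1, r - 2 ≤ {w | (u, w) ∈ K.2}.ncard

open Classical in
/-- The set of all copies in `D` of digraphs on `r` vertices with minimum out-degree at least
`r - 2` and complete base graph. -/
noncomputable def tileCopies {V : Type*} [Fintype V] (r : ℕ) (D : Digraph V) :
    Finset (Finset V × Finset (V × V)) :=
  Finset.univ.filter (IsTileCopy r D)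

open Classical in
/-- The total weight of the copies that contain the vertex `v`. -/
noncomputable def tileWeightAt {V : Type*} [Fintype V] (r : ℕ) (D : Digraph V)
    (ω : Finset V × Finset (V × V) → ℝ) (v : V) : ℝ :=
  ∑ K ∈ (tileCopies r D).filter (fun K => v ∈ K.1), ω K

/-- `ω` is a fractional `(r, r-2)`-tiling of `D`; only its values on `tileCopies r D` matter. -/
def IsFractionalTiling {V : Type*} [Fintype V] (r : ℕ) (D : Digraph V)
    (ω : Finset V × Finset (V × V) → ℝ) : Prop :=
  (∀ K ∈ tileCopies r D, ω K ∈ Set.Icc (0 : ℝ) 1) ∧ ∀ v, tileWeightAt r D ω v ≤ 1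

/-- `D` contains a perfect fractional `(r, r-2)`-tiling. -/
def HasPerfectFractionalTiling {V : Type*} [Fintype V] (r : ℕ) (D : Digraph V) : Prop :=
  ∃ ω, IsFractionalTiling r D ω ∧ ∀ v, tileWeightAt r D ω v = 1

/-- The colour degree of `v`: the number of distinct colours on edges incident to `v`. -/
noncomputable def colourDeg {V C : Type*} {G : SimpleGraph V} (c : G.EdgeLabeling C) (v : V) : ℕ :=
  {κ | ∃ e : G.edgeSet, v ∈ (e : Sym2 V) ∧ c e = κ}.ncard

/-- The minimum colour degree of an edge-coloured graph. -/
noncomputable def minColourDeg {V C : Type*} {G : SimpleGraph V} (c : G.EdgeLabeling C) : ℕ :=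
  ⨅ v, colourDeg c v

/-- `S` is the vertex set of a rainbow `K_r`: an `r`-clique whose edges have distinct colours. -/
def IsRainbowClique {V C : Type*} {G : SimpleGraph V} (c : G.EdgeLabeling C) (r : ℕ)
    (S : Finset V) : Prop :=
  G.IsNClique r S ∧
    ∀ e f : G.edgeSet, (∀ v ∈ (e : Sym2 V), v ∈ S) → (∀ v ∈ (f : Sym2 V), v ∈ S) →
      c e = c f → e = f

/-- `T` is (the family of vertex sets of) a rainbow-`K_r`-tiling: a collection of vertex-disjoint
rainbow copies of `K_r`. -/
def IsRainbowCliqueTiling {V C : Type*} {G : SimpleGraph V} (c : G.EdgeLabeling C) (r : ℕ)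
    (T : Finset (Finset V)) : Prop :=
  (∀ S ∈ T, IsRainbowClique c r S) ∧ ∀ S ∈ T, ∀ S' ∈ T, S ≠ S' → Disjoint S S'

/-- The number of vertices that lie in no member of `T`. -/
noncomputable def numUncovered {V : Type*} (T : Finset (Finset V)) : ℕ :=
  {v | ∀ S ∈ T, v ∉ S}.ncard

end AlmostTiling

/-!
Orient `G` by keeping at each vertex one out-neighbour per colour; the out-degrees of the resulting
digraph `D` are the colour degrees. Suppose that a maximum rainbow tiling `T` leaves too many
vertices uncovered, and cut the vertex set into blocks of size `r`: the members of `T`, and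
`r`-subsets of the uncovered set. A random sequence of about `t / r` blocks spans a digraph on `t`
vertices, once the arcs inside blocks are dropped. By a second moment computation the expected
number of its vertices of out-degree below `δ t` is bounded independently of `t`, whereas the
expected number of uncovered blocks in the sequence is proportional to `t`. Hence a positive
proportion of the sequences has at least two more uncovered blocks than vertices of low out-degree,
and a counting argument for partite hypergraphs yields a blow-up in `D`, with large parts, of one
such sample `R`.

Adding all arcs out of the set `F` of vertices of low out-degree gives a digraph with a perfect
fractional tiling, and its tiles that avoid `F` are tiles of `R`. Rounding the tiling and embedding
these tiles greedily in the blow-up, avoiding coincidences of colours, gives more disjoint rainbow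
cliques than there are members of `T` meeting the blow-up, which contradicts the choice of `T`.
-/

open Finset Function
open scoped BigOperators

section Sequences

variable {ι β : Type*} [Fintype ι] [DecidableEq ι] [Fintype β]

theorem expect_expect_update (F : (ι → β) → ℝ) (k : ι) :
    𝔼 x, 𝔼 y, F (update x k y) = 𝔼 x, F x := by
  rcases isEmpty_or_nonempty β with hβ | hβ
  · have : IsEmpty (ι → β) := ⟨fun x => hβ.elim (x k)⟩
    simp
  · have swap_involutive : Involutive fun a : (ι → β) × β => (update a.1 k a.2, a.1 k) :=
      fun a => by simp
    calc 𝔼 x, 𝔼 y, F (update x k y)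
        = 𝔼 a : (ι → β) × β, F (update a.1 k a.2) := by
          rw [← univ_product_univ, expect_product]
      _ = 𝔼 a : (ι → β) × β, F a.1 :=
          Fintype.expect_equiv swap_involutive.toPerm _ _ fun _ => rfl
      _ = 𝔼 x, F x := by
          rw [← univ_product_univ, expect_product]
          simp

theorem expect_sq_sum_le [Nonempty β] {g : β → β → ℝ} {M : ℝ} (hg : ∀ z, 𝔼 y, g z y = 0)
    (hM : ∀ z y, |g z y| ≤ M) (i : ι) :
    𝔼 x : ι → β, (∑ j, g (x i) (x j)) ^ 2 ≤ Fintype.card ι * M ^ 2 := by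
  have expect_mul_eq_zero_of_ne : ∀ k l, k ≠ l → k ≠ i →
      𝔼 x : ι → β, g (x i) (x k) * g (x i) (x l) = 0 := by
    intro k l hkl hki
    rw [← expect_expect_update _ k]
    simp only [update_of_ne hki.symm, update_of_ne hkl.symm, update_self, ← expect_mul, hg,
      zero_mul, expect_const_zero]
  have expect_mul_eq_zero : ∀ k l, k ≠ l →
      𝔼 x : ι → β, g (x i) (x k) * g (x i) (x l) = 0 := by
    intro k l hkl
    rcases eq_or_ne k i with rfl | hk
    · simpa only [mul_comm] using expect_mul_eq_zero_of_ne l k hkl.symm hkl.symm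
    · exact expect_mul_eq_zero_of_ne k l hkl hk
  calc 𝔼 x : ι → β, (∑ j, g (x i) (x j)) ^ 2
      = ∑ k, ∑ l, 𝔼 x : ι → β, g (x i) (x k) * g (x i) (x l) := by
        simp only [sq, sum_mul_sum]
        rw [expect_sum_comm]
        exact sum_congr rfl fun k _ => expect_sum_comm _ _ _
    _ = ∑ k, 𝔼 x : ι → β, g (x i) (x k) * g (x i) (x k) :=
        sum_congr rfl fun k _ => Fintype.sum_eq_single k fun l hl => expect_mul_eq_zero k l hl.symm
    _ ≤ ∑ _k : ι, M ^ 2 := by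
        refine sum_le_sum fun k _ => ?_
        simp only [← sq]
        exact expect_le univ_nonempty fun x _ =>
          sq_le_sq' (abs_le.1 (hM _ _)).1 (abs_le.1 (hM _ _)).2
    _ = Fintype.card ι * M ^ 2 := by simp

theorem expect_card_filter_mem [Nonempty β] [DecidableEq β] (U : Finset β) :
    𝔼 x : ι → β, (#{j | x j ∈ U} : ℝ) = Fintype.card ι * (#U / Fintype.card β) := by
  have expect_mem : ∀ j, 𝔼 x : ι → β, (if x j ∈ U then 1 else 0 : ℝ) = #U / Fintype.card β := by
    intro j
    rw [← expect_expect_update _ j]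
    simp [Fintype.expect_eq_sum_div_card]
  simp only [← sum_boole]
  rw [expect_sum_comm]
  simp [expect_mem]

end Sequences

theorem expect_fin_cons {β : Type*} [Fintype β] {q : ℕ} (F : (Fin (q + 1) → β) → ℝ) :
    𝔼 x, F x = 𝔼 y, 𝔼 x, F (Fin.cons y x) := by
  rw [← expect_product', univ_product_univ]
  exact (Fintype.expect_equiv (Fin.consEquiv fun _ => β) _ _ fun _ => rfl).symm

theorem pow_expect_le_expect_pow {α : Type*} [Fintype α] [Nonempty α] {f : α → ℝ}
    (hf : ∀ x, 0 ≤ f x) (n : ℕ) : (𝔼 x, f x) ^ n ≤ 𝔼 x, f x ^ n := by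
  have := Real.pow_arith_mean_le_arith_mean_pow univ (fun _ : α => (Fintype.card α : ℝ)⁻¹) f
    (fun _ _ => by positivity) (by simp) (fun x _ => hf x) n
  simpa only [← mul_sum, Fintype.expect_eq_sum_div_card, div_eq_inv_mul] using this

/- Expose one coordinate at a time: by Jensen, replacing its single value by `k` independent ones
costs at most a `k`-th power, and the other coordinates are then handled by induction for the
product of the `k` resulting functions. -/
theorem pow_expect_le_expect_prod {β : Type*} [Fintype β] [Nonempty β] (k : ℕ) {q : ℕ}
    {w : (Fin q → β) → ℝ} (hw : ∀ x, 0 ≤ w x) :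
    (𝔼 x, w x) ^ k ^ q ≤
      𝔼 f : Fin q → Fin k → β, ∏ σ : Fin q → Fin k, w fun j => f j (σ j) := by
  induction q with
  | zero => simp [univ_unique, Subsingleton.elim _ (default : Fin 0 → β)]
  | succ q ih =>
    let w' (a : Fin k → β) (x : Fin q → β) : ℝ := ∏ i, w (Fin.cons (a i) x)
    have hw' : ∀ a x, 0 ≤ w' a x := fun a x => prod_nonneg fun i _ => hw _
    have pow_expect_cons : ∀ x, (𝔼 y, w (Fin.cons y x)) ^ k = 𝔼 a, w' a x := fun x => by
      rw [expect_pow, Fintype.piFinset_univ]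
    have prod_cons : ∀ (a : Fin k → β) (g : Fin q → Fin k → β),
        ∏ σ : Fin q → Fin k, w' a (fun j => g j (σ j)) =
          ∏ σ : Fin (q + 1) → Fin k,
            w fun j => (Fin.cons a g : Fin (q + 1) → Fin k → β) j (σ j) := by
      intro a g
      rw [← (Fin.consEquiv fun _ => Fin k).prod_comp, Fintype.prod_prod_type, prod_comm]
      refine prod_congr rfl fun σ _ => prod_congr rfl fun i _ => congrArg w ?_
      ext j
      refine Fin.cases ?_ (fun j => ?_) j <;> simp [Fin.consEquiv]
    calc (𝔼 x, w x) ^ k ^ (q + 1)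
        = ((𝔼 x, 𝔼 y, w (Fin.cons y x)) ^ k) ^ k ^ q := by
          rw [expect_fin_cons, expect_comm, ← pow_mul, pow_succ' k]
      _ ≤ (𝔼 x, (𝔼 y, w (Fin.cons y x)) ^ k) ^ k ^ q :=
          pow_le_pow_left₀ (pow_nonneg (expect_nonneg fun x _ => expect_nonneg fun y _ => hw _) k)
            (pow_expect_le_expect_pow (fun x => expect_nonneg fun y _ => hw _) k) _
      _ = (𝔼 a, 𝔼 x, w' a x) ^ k ^ q := by
          simp only [pow_expect_cons]
          rw [expect_comm]
      _ ≤ 𝔼 a, (𝔼 x, w' a x) ^ k ^ q :=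
          pow_expect_le_expect_pow (fun a => expect_nonneg fun x _ => hw' a x) _
      _ ≤ 𝔼 a, 𝔼 g : Fin q → Fin k → β, ∏ σ : Fin q → Fin k, w' a fun j => g j (σ j) :=
          expect_le_expect fun a _ => ih (hw' a)
      _ = 𝔼 f : Fin (q + 1) → Fin k → β, ∏ σ : Fin (q + 1) → Fin k, w fun j => f j (σ j) := by
          rw [expect_fin_cons]
          simp only [prod_cons]

theorem expect_le_of_nonpos_of_injective {ι β : Type*} [Fintype ι] [DecidableEq ι] [Fintype β]
    [Nonempty β] {F : (ι → β) → ℝ} (hF : ∀ f, F f ≤ 1) (hinj : ∀ f, Injective f → F f ≤ 0) :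
    𝔼 f, F f ≤ (Fintype.card ι : ℝ) ^ 2 / Fintype.card β := by
  classical
  have expect_collision : ∀ a : ι × ι, a.1 ≠ a.2 →
      𝔼 f : ι → β, (if f a.1 = f a.2 then 1 else 0 : ℝ) = 1 / Fintype.card β := by
    intro a ha
    rw [← expect_expect_update _ a.1]
    simp [update_of_ne ha.symm]
  calc 𝔼 f, F f
      ≤ 𝔼 f : ι → β, ∑ a : ι × ι with a.1 ≠ a.2, (if f a.1 = f a.2 then 1 else 0 : ℝ) := by
        refine expect_le_expect fun f _ => ?_
        by_cases hf : Injective f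
        · exact (hinj f hf).trans (sum_nonneg fun _ _ => by positivity)
        · simp only [Injective, not_forall] at hf
          obtain ⟨a, b, hfab, hab⟩ := hf
          refine le_trans ?_ (single_le_sum (fun _ _ => by positivity)
            (mem_filter.2 ⟨mem_univ (a, b), hab⟩))
          simpa [hfab] using hF f
    _ = ∑ a : ι × ι with a.1 ≠ a.2, (1 / Fintype.card β : ℝ) := by
        rw [expect_sum_comm]
        exact sum_congr rfl fun a ha => expect_collision a (mem_filter.1 ha).2
    _ ≤ ∑ _a : ι × ι, (1 / Fintype.card β : ℝ) :=
        sum_le_sum_of_subset_of_nonneg (filter_subset _ _) fun _ _ _ => by positivity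
    _ = (Fintype.card ι : ℝ) ^ 2 / Fintype.card β := by
        simp [sq, div_eq_mul_inv]

theorem exists_blowup_subset {β : Type*} [Fintype β] [Nonempty β] {q k : ℕ}
    {E : Finset (Fin q → β)}
    (hE : (Fintype.card (Fin q × Fin k) : ℝ) ^ 2 / Fintype.card β <
      (#E / Fintype.card β ^ q) ^ k ^ q) :
    ∃ f : Fin q → Fin k → β, Injective2 f ∧ ∀ σ : Fin q → Fin k, (fun j => f j (σ j)) ∈ E := by
  classical
  by_contra! hf
  let w : (Fin q → β) → ℝ := fun x => if x ∈ E then 1 else 0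
  let F : (Fin q × Fin k → β) → ℝ := fun f => ∏ σ : Fin q → Fin k, w fun j => f (j, σ j)
  have expect_w : 𝔼 x, w x = #E / Fintype.card β ^ q := by
    simp [w, Fintype.expect_eq_sum_div_card]
  have F_le_one : ∀ f, F f ≤ 1 := fun f => prod_le_one (fun _ _ => by positivity) fun σ _ => by
    simp only [w]; split_ifs <;> norm_num
  have F_nonpos : ∀ f, Injective f → F f ≤ 0 := fun f hinj => by
    obtain ⟨σ, hσ⟩ := hf (curry f) fun _ _ _ _ h => Prod.ext_iff.1 (hinj h)
    exact (prod_eq_zero (mem_univ σ) (if_neg hσ)).le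
  refine hE.not_ge ?_
  calc (#E / Fintype.card β ^ q : ℝ) ^ k ^ q
      = (𝔼 x, w x) ^ k ^ q := by rw [expect_w]
    _ ≤ 𝔼 f : Fin q → Fin k → β, ∏ σ : Fin q → Fin k, w fun j => f j (σ j) :=
        pow_expect_le_expect_prod k fun _ => by positivity
    _ = 𝔼 f, F f :=
        (Fintype.expect_equiv (Equiv.curry _ _ _) _ _ fun _ => rfl).symm
    _ ≤ (Fintype.card (Fin q × Fin k) : ℝ) ^ 2 / Fintype.card β :=
        expect_le_of_nonpos_of_injective F_le_one F_nonpos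

theorem exists_monochromatic_blowup (q k : ℕ) (Θ : Type*) [Finite Θ] [Nonempty Θ] {d : ℝ}
    (hd : 0 < d) : ∃ N₀ : ℕ, ∀ (β : Type*) [Fintype β], N₀ ≤ Fintype.card β →
      ∀ (E : Finset (Fin q → β)) (τ : (Fin q → β) → Θ), d * Fintype.card β ^ q ≤ #E →
      ∃ (θ : Θ) (f : Fin q → Fin k → β), Injective2 f ∧
        ∀ σ : Fin q → Fin k, (fun j => f j (σ j)) ∈ E ∧ τ (fun j => f j (σ j)) = θ := by
  classical
  have := Fintype.ofFinite Θ
  obtain ⟨N₀, hN₀⟩ := exists_nat_gt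
    ((Fintype.card (Fin q × Fin k) : ℝ) ^ 2 / (d / Fintype.card Θ) ^ k ^ q)
  refine ⟨N₀, fun β _ hβ E τ hE => ?_⟩
  replace hN₀ := hN₀.trans_le (Nat.cast_le.2 hβ)
  have card_pos : (0 : ℝ) < Fintype.card β := lt_of_le_of_lt (by positivity) hN₀
  have : Nonempty β := Fintype.card_pos_iff.1 (Nat.cast_pos.1 card_pos)
  obtain ⟨θ, -, hθ⟩ := exists_le_card_fiber_of_nsmul_le_card_of_maps_to (M := ℝ)
    (b := d / Fintype.card Θ * Fintype.card β ^ q) (fun x _ => mem_univ (τ x))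
    univ_nonempty (by
      rw [card_univ, nsmul_eq_mul, ← mul_assoc, mul_div_cancel₀ _ (by positivity)]
      exact hE)
  obtain ⟨f, hf, hfE⟩ := exists_blowup_subset (k := k) (E := {x ∈ E | τ x = θ}) <|
    calc (Fintype.card (Fin q × Fin k) : ℝ) ^ 2 / Fintype.card β
        < (d / Fintype.card Θ) ^ k ^ q := (div_lt_comm₀ (by positivity) card_pos).1 hN₀
      _ ≤ _ := pow_le_pow_left₀ (by positivity) ((le_div_iff₀ (by positivity)).2 hθ) _
  exact ⟨θ, f, hf, fun σ => mem_filter.1 (hfE σ)⟩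

theorem exists_transversal_avoiding {W I A : Type*} [Finite W] [DecidableEq W]
    {Y : W → Finset I} {s : Finset A} {bad : A → (W → I) → Prop}
    (hbad : ∀ a ∈ s, ∃ p, ∀ h k, bad a h → bad a (update h p k) → h p = k)
    (hY : ∀ v, #s < #(Y v)) : ∃ h : W → I, (∀ v, h v ∈ Y v) ∧ ∀ a ∈ s, ¬ bad a h := by
  classical
  have := Fintype.ofFinite W
  set P := Fintype.piFinset Y
  have card_bad : ∀ a ∈ s, #{h ∈ P | bad a h} * (#s + 1) ≤ #P := by
    intro a ha
    obtain ⟨p, hp⟩ := hbad a ha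
    calc #{h ∈ P | bad a h} * (#s + 1) ≤ #{h ∈ P | bad a h} * #(Y p) :=
          Nat.mul_le_mul_left _ (hY p)
      _ = #({h ∈ P | bad a h} ×ˢ Y p) := (card_product _ _).symm
      _ ≤ #P := by
        refine card_le_card_of_injOn (fun b => update b.1 p b.2) (fun b hb => ?_) ?_
        · simp only [coe_product, Set.mem_prod, mem_coe, mem_filter, P, Fintype.mem_piFinset]
            at hb ⊢
          exact (forall_update_iff b.1 fun v k => k ∈ Y v).2 ⟨hb.2, fun v _ => hb.1.1 v⟩
        · rintro ⟨h, k⟩ hb ⟨h', k'⟩ hb' heq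
          simp only [coe_product, Set.mem_prod, mem_coe, mem_filter] at hb hb' heq
          have hh' : update h p (h' p) = h' := by
            rw [← update_idem k, heq, update_idem, update_eq_self]
          have hkk' : k = k' := by simpa using congrFun heq p
          have hp' : h p = h' p := hp h (h' p) hb.1.2 (by rw [hh']; exact hb'.1.2)
          rw [← hp', update_eq_self] at hh'
          rw [hh', hkk']
  by_contra! hcover
  have card_le : #P ≤ ∑ a ∈ s, #{h ∈ P | bad a h} :=
    (card_le_card fun h hh => by
      obtain ⟨a, ha, hah⟩ := hcover h (Fintype.mem_piFinset.1 hh)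
      exact mem_biUnion.2 ⟨a, ha, mem_filter.2 ⟨hh, hah⟩⟩).trans card_biUnion_le
  have card_pos : 0 < #P := Finset.card_pos.2 <| Fintype.piFinset_nonempty.2 fun v =>
    Finset.card_pos.1 ((Nat.zero_le _).trans_lt (hY v))
  have : #P * (#s + 1) ≤ #P * #s := calc
    #P * (#s + 1) ≤ ∑ a ∈ s, #{h ∈ P | bad a h} * (#s + 1) := by
        rw [← sum_mul]; exact Nat.mul_le_mul_right _ card_le
    _ ≤ #P * #s := by
        rw [mul_comm]; exact sum_le_card_nsmul _ _ _ card_bad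
  exact absurd (Nat.le_of_mul_le_mul_left this card_pos) (by omega)

section OutRainbow

variable {V C : Type*} {G : SimpleGraph V}

open Classical in
/-- The colour of an unordered pair, with the extra value `none` for a non-edge. -/
noncomputable def pairColour (c : G.EdgeLabeling C) (e : Sym2 V) : Option C :=
  if h : e ∈ G.edgeSet then some (c ⟨e, h⟩) else none

theorem pairColour_coe (c : G.EdgeLabeling C) (e : G.edgeSet) : pairColour c e = some (c e) := by
  simp [pairColour]

/-- `D` is an orientation of edges of `G` (possibly in both directions) in which the arcs leaving
any given vertex have distinct colours. -/
structure IsOutRainbow (c : G.EdgeLabeling C) (D : Digraph V) : Prop where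
  adj : ∀ {v w}, D.Adj v w → G.Adj v w
  injOn_pairColour : ∀ v, Set.InjOn (fun w => pairColour c s(v, w)) {w | D.Adj v w}

theorem IsOutRainbow.digraphLoopless {c : G.EdgeLabeling C} {D : Digraph V}
    (hD : IsOutRainbow c D) : DigraphLoopless D :=
  fun _ h => G.loopless.irrefl _ (hD.adj h)

theorem exists_isOutRainbow [Finite V] (c : G.EdgeLabeling C) :
    ∃ D : Digraph V, IsOutRainbow c D ∧ ∀ v, colourDeg c v ≤ outDeg D v := by
  choose N hN hbij using fun v : V =>
    Set.exists_subset_bijOn {w | G.Adj v w} (fun w => pairColour c s(v, w))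
  refine ⟨⟨fun v w => w ∈ N v⟩, ⟨fun h => hN _ h, fun v => (hbij v).injOn⟩, fun v => ?_⟩
  calc colourDeg c v = (some '' {κ | ∃ e : G.edgeSet, v ∈ (e : Sym2 V) ∧ c e = κ}).ncard :=
        (Set.ncard_image_of_injective _ (Option.some_injective C)).symm
    _ ≤ ((fun w => pairColour c s(v, w)) '' {w | G.Adj v w}).ncard := by
        refine Set.ncard_le_ncard ?_ (Set.toFinite _)
        rintro _ ⟨_, ⟨⟨e, he⟩, hv, rfl⟩, rfl⟩
        obtain ⟨w, rfl⟩ := Sym2.mem_iff_exists.1 hv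
        exact ⟨w, he, pairColour_coe c ⟨s(v, w), he⟩⟩
    _ = (N v).ncard := by rw [← (hbij v).image_eq, (hbij v).injOn.ncard_image]

end OutRainbow

namespace IsTileCopy

variable {W : Type*} {r : ℕ} {R : Digraph W} {K : Finset W × Finset (W × W)}

theorem exists_arc (hK : IsTileCopy r R K) {e : Sym2 W} (he : e ∈ K.1.sym2) (hd : ¬ e.IsDiag) :
    ∃ u p, (u, p) ∈ K.2 ∧ s(u, p) = e := by
  induction e with | _ x y
  rw [mk_mem_sym2_iff] at he
  rcases hK.base_complete x he.1 y he.2 hd with h | h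
  · exact ⟨x, y, h, rfl⟩
  · exact ⟨y, x, h, Sym2.eq_swap⟩

theorem arc_or_arc (hK : IsTileCopy r R K) (hR : DigraphLoopless R) {x y z : W}
    (hx : x ∈ K.1) (hy : y ∈ K.1) (hz : z ∈ K.1) (hxy : x ≠ y) (hzy : z ≠ y) (hxz : x ≠ z) :
    (y, x) ∈ K.2 ∨ (y, z) ∈ K.2 := by
  classical
  by_contra! h
  have card_triple : #{x, y, z} = 3 := card_eq_three.2 ⟨x, y, z, hxy, hxz, hzy.symm, rfl⟩
  have triple_subset : {x, y, z} ⊆ K.1 := by simp [insert_subset_iff, hx, hy, hz]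
  have outNbrs_subset : {w | (y, w) ∈ K.2} ⊆ ((K.1 \ {x, y, z} : Finset W) : Set W) := by
    intro w hw
    simp only [coe_sdiff, Set.mem_sdiff, mem_coe, mem_insert, mem_singleton]
    refine ⟨(hK.arcs_mem _ hw).2, ?_⟩
    rintro (rfl | rfl | rfl)
    exacts [h.1 hw, hR _ (hK.arcs_adj _ hw), h.2 hw]
  have card_outNbrs := Set.ncard_le_ncard outNbrs_subset (finite_toSet _)
  rw [Set.ncard_coe_finset, card_sdiff_of_subset triple_subset, card_triple, hK.card_verts]
    at card_outNbrs
  have three_le := card_le_card triple_subset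
  rw [card_triple, hK.card_verts] at three_le
  have := hK.le_outDeg y hy
  omega

theorem exists_arc_head_notMem (hK : IsTileCopy r R K) (hR : DigraphLoopless R) {e f : Sym2 W}
    (he : e ∈ K.1.sym2) (hf : f ∈ K.1.sym2) (hed : ¬ e.IsDiag) (hfd : ¬ f.IsDiag)
    (hef : e ≠ f) :
    ∃ u p, (u, p) ∈ K.2 ∧ (s(u, p) = e ∧ p ∉ f ∨ s(u, p) = f ∧ p ∉ e) := by
  obtain ⟨x, y, hxy, rfl⟩ := hK.exists_arc he hed
  obtain ⟨z, w, hzw, rfl⟩ := hK.exists_arc hf hfd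
  rw [mk_mem_sym2_iff] at he hf
  rw [Sym2.mk_isDiag_iff] at hed hfd
  by_cases hy : y ∈ s(z, w)
  swap
  · exact ⟨x, y, hxy, .inl ⟨rfl, hy⟩⟩
  by_cases hw : w ∈ s(x, y)
  swap
  · exact ⟨z, w, hzw, .inr ⟨rfl, hw⟩⟩
  rw [Sym2.mem_iff] at hy hw
  -- The two heads agree; their common value has an arc back to one of the two tails.
  obtain rfl : y = w := by
    rcases hy with rfl | rfl
    · rcases hw with rfl | rfl
      · exact absurd Sym2.eq_swap hef
      · rfl
    · rfl
  have hxz : x ≠ z := by rintro rfl; exact hef rfl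
  rcases hK.arc_or_arc hR he.1 he.2 hf.1 hed hfd hxz with h | h
  · exact ⟨y, x, h, .inl ⟨Sym2.eq_swap, by simp [hxz, hed]⟩⟩
  · exact ⟨y, z, h, .inr ⟨Sym2.eq_swap, by simp [hxz.symm, hfd]⟩⟩

end IsTileCopy

namespace IsRainbowCliqueTiling

variable {V C : Type*} {G : SimpleGraph V} {c : G.EdgeLabeling C} {r : ℕ} {T T' : Finset (Finset V)}

theorem of_subset (hT : IsRainbowCliqueTiling c r T) (h : T' ⊆ T) : IsRainbowCliqueTiling c r T' :=
  ⟨fun S hS => hT.1 S (h hS), fun S hS S' hS' => hT.2 S (h hS) S' (h hS')⟩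

theorem singleton {S : Finset V} (hS : IsRainbowClique c r S) : IsRainbowCliqueTiling c r {S} := by
  refine ⟨by simpa using hS, fun S₁ h₁ S₂ h₂ hne => ?_⟩
  rw [mem_singleton] at h₁ h₂
  exact absurd (h₁.trans h₂.symm) hne

theorem union [DecidableEq V] (hT : IsRainbowCliqueTiling c r T)
    (hT' : IsRainbowCliqueTiling c r T') (h : ∀ S ∈ T, ∀ S' ∈ T', Disjoint S S') :
    IsRainbowCliqueTiling c r (T ∪ T') := by
  refine ⟨fun S hS => (mem_union.1 hS).elim (hT.1 S) (hT'.1 S), fun S hS S' hS' hne => ?_⟩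
  rcases mem_union.1 hS with hS | hS <;> rcases mem_union.1 hS' with hS' | hS'
  · exact hT.2 S hS S' hS' hne
  · exact h S hS S' hS'
  · exact (h S' hS' S hS).symm
  · exact hT'.2 S hS S' hS' hne

theorem card_union [DecidableEq V] (hr : 0 < r) (hT : IsRainbowCliqueTiling c r T)
    (h : ∀ S ∈ T, ∀ S' ∈ T', Disjoint S S') : #(T ∪ T') = #T + #T' := by
  refine card_union_of_disjoint (disjoint_left.2 fun S hS hS' => ?_)
  rw [← (hT.1 S hS).1.card_eq, disjoint_self_iff_empty S |>.1 (h S hS S hS'), card_empty] at hr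
  exact hr.false

theorem card_add_numUncovered [Fintype V] (hT : IsRainbowCliqueTiling c r T) :
    r * #T + numUncovered T = Fintype.card V := by
  classical
  have uncovered_eq : {v | ∀ S ∈ T, v ∉ S} = (((T.biUnion id)ᶜ : Finset V) : Set V) := by
    ext; simp
  have card_covered : #(T.biUnion id) = #T * r :=
    (card_biUnion hT.2).trans (sum_const_nat fun S hS => (hT.1 S hS).1.card_eq)
  rw [numUncovered, uncovered_eq, Set.ncard_coe_finset, mul_comm, ← card_covered,
    card_add_card_compl]

end IsRainbowCliqueTiling

/-- The parts `range (φ v)` form a copy in `D` of a blow-up of the digraph `R`: they are disjoint,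
each is indexed by `I`, and every arc of `R` becomes a complete bipartite digraph. -/
structure IsBlowUp {V W I : Type*} (R : Digraph W) (D : Digraph V) (φ : W → I → V) : Prop where
  injective2 : Injective2 φ
  adj : ∀ {v w}, R.Adj v w → ∀ k l, D.Adj (φ v k) (φ w l)

/-- The number of pairs of unordered pairs in an `r`-set. It bounds the number of coincidences of
colours that have to be avoided when a tile on `r` vertices is embedded in a blow-up. -/
def conflictBound (r : ℕ) : ℕ :=
  (r + 1).choose 2 ^ 2

namespace IsBlowUp

variable {V C W I : Type*} {G : SimpleGraph V} {c : G.EdgeLabeling C} {D : Digraph V}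
  {R : Digraph W} {r : ℕ} {φ : W → I → V} {K : Finset W × Finset (W × W)}

theorem digraphLoopless [Nonempty I] (hφ : IsBlowUp R D φ) (hD : DigraphLoopless D) :
    DigraphLoopless R :=
  fun _ h => hD _ (hφ.adj h (Classical.arbitrary I) (Classical.arbitrary I))

theorem injective_transversal (hφ : IsBlowUp R D φ) (h : W → I) :
    Injective fun v => φ v (h v) :=
  fun _ _ hvw => (hφ.injective2 hvw).1

theorem isRainbowClique_image [DecidableEq V] (hφ : IsBlowUp R D φ) (hD : IsOutRainbow c D)
    (hK : IsTileCopy r R K) {h : W → I}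
    (hh : Set.InjOn (fun e : Sym2 W => pairColour c (e.map fun v => φ v (h v)))
      {e | e ∈ K.1.sym2 ∧ ¬ e.IsDiag}) :
    IsRainbowClique c r (K.1.image fun v => φ v (h v)) := by
  have hinj := hφ.injective_transversal h
  refine ⟨⟨?_, by rw [card_image_of_injective _ hinj, hK.card_verts]⟩, fun e f he hf hef => ?_⟩
  · rw [coe_image]
    rintro _ ⟨x, hx, rfl⟩ _ ⟨y, hy, rfl⟩ hxy
    rcases hK.base_complete x hx y hy (ne_of_apply_ne (fun v => φ v (h v)) hxy) with h1 | h1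
    · exact hD.adj (hφ.adj (hK.arcs_adj _ h1) _ _)
    · exact (hD.adj (hφ.adj (hK.arcs_adj _ h1) _ _)).symm
  · have exists_preimage : ∀ e : G.edgeSet,
        (∀ v ∈ (e : Sym2 V), v ∈ K.1.image fun v => φ v (h v)) →
        ∃ e' : Sym2 W, (e' ∈ K.1.sym2 ∧ ¬ e'.IsDiag) ∧ e'.map (fun v => φ v (h v)) = e := by
      rintro ⟨e, he⟩ hmem
      induction e with | _ a b
      obtain ⟨x, hx, rfl⟩ := mem_image.1 (hmem a (Sym2.mem_mk_left _ _))
      obtain ⟨y, hy, rfl⟩ := mem_image.1 (hmem b (Sym2.mem_mk_right _ _))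
      refine ⟨s(x, y), ⟨mk_mem_sym2_iff.2 ⟨hx, hy⟩, ?_⟩, rfl⟩
      intro hxy
      obtain rfl : x = y := hxy
      exact G.loopless.irrefl _ he
    obtain ⟨e', he', hee'⟩ := exists_preimage e he
    obtain ⟨f', hf', hff'⟩ := exists_preimage f hf
    have : e' = f' := hh he' hf' (by simp only [hee', hff', pairColour_coe, hef])
    exact Subtype.ext (by rw [← hee', ← hff', this])

theorem eq_of_pairColour_update [DecidableEq W] (hφ : IsBlowUp R D φ) (hD : IsOutRainbow c D)
    {u p : W} (hup : R.Adj u p) (hne : u ≠ p) {f : Sym2 W} (hp : p ∉ f) {h : W → I} {k : I}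
    (h₁ : pairColour c (Sym2.map (fun v => φ v (h v)) s(u, p)) =
      pairColour c (f.map fun v => φ v (h v)))
    (h₂ : pairColour c (Sym2.map (fun v => φ v (update h p k v)) s(u, p)) =
      pairColour c (f.map fun v => φ v (update h p k v))) : h p = k := by
  have map_update : (f.map fun v => φ v (update h p k v)) = f.map fun v => φ v (h v) :=
    Sym2.map_congr fun v hv => by rw [update_of_ne (ne_of_mem_of_not_mem hv hp)]
  rw [map_update, ← h₁] at h₂
  simp only [Sym2.map_mk, update_of_ne hne, update_self] at h₂
  exact ((hφ.injective2 (hD.injOn_pairColour _ (hφ.adj hup _ _) (hφ.adj hup _ _) h₂)).2).symm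

theorem exists_isRainbowClique [Finite W] [DecidableEq V] (hφ : IsBlowUp R D φ)
    (hD : IsOutRainbow c D) (hK : IsTileCopy r R K) {Y : W → Finset I}
    (hY : ∀ v, conflictBound r < #(Y v)) :
    ∃ h : W → I, (∀ v, h v ∈ Y v) ∧ IsRainbowClique c r (K.1.image fun v => φ v (h v)) := by
  classical
  have hR : DigraphLoopless R := fun v =>
    have : Nonempty I := ⟨(card_pos.1 ((Nat.zero_le _).trans_lt (hY v))).choose⟩
    hφ.digraphLoopless hD.digraphLoopless v
  let conflicts : Finset (Sym2 W × Sym2 W) :=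
    {a ∈ K.1.sym2 ×ˢ K.1.sym2 | ¬ a.1.IsDiag ∧ ¬ a.2.IsDiag ∧ a.1 ≠ a.2}
  have card_conflicts : #conflicts ≤ conflictBound r := by
    refine (card_filter_le _ _).trans_eq ?_
    rw [card_product, card_sym2, hK.card_verts, conflictBound, sq]
  let bad (a : Sym2 W × Sym2 W) (h : W → I) : Prop :=
    pairColour c (a.1.map fun v => φ v (h v)) = pairColour c (a.2.map fun v => φ v (h v))
  have bad_update : ∀ a ∈ conflicts, ∃ p, ∀ h k, bad a h → bad a (update h p k) → h p = k := by
    rintro ⟨e, f⟩ ha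
    obtain ⟨hef, hed, hfd, hne⟩ := mem_filter.1 ha
    obtain ⟨he, hf⟩ := mem_product.1 hef
    obtain ⟨u, p, hup, ⟨rfl, hp⟩ | ⟨rfl, hp⟩⟩ := hK.exists_arc_head_notMem hR he hf hed hfd hne
    · exact ⟨p, fun h k h₁ h₂ => hφ.eq_of_pairColour_update hD (hK.arcs_adj _ hup) hed hp h₁ h₂⟩
    · exact ⟨p, fun h k h₁ h₂ =>
        hφ.eq_of_pairColour_update hD (hK.arcs_adj _ hup) hfd hp h₁.symm h₂.symm⟩
  obtain ⟨h, hhY, hh⟩ :=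
    exists_transversal_avoiding bad_update fun v => card_conflicts.trans_lt (hY v)
  refine ⟨h, hhY, hφ.isRainbowClique_image hD hK fun e he f hf hef => ?_⟩
  by_contra hne
  exact hh (e, f) (mem_filter.2 ⟨mk_mem_product he.1 hf.1, he.2, hf.2, hne⟩) hef

open Classical in
theorem used_union_subset [Fintype I] (hφ : IsBlowUp R D φ) {s : Finset W} (h : W → I)
    (T : Finset (Finset V)) (v : W) :
    ({k | ∃ S ∈ {s.image fun v => φ v (h v)} ∪ T, φ v k ∈ S} : Finset I) ⊆
      ({k | ∃ S ∈ T, φ v k ∈ S} : Finset I) ∪ if v ∈ s then {h v} else ∅ := by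
  intro k hk
  obtain ⟨S, hS, hkS⟩ := (mem_filter.1 hk).2
  rcases mem_union.1 hS with hS | hS
  · rw [mem_singleton.1 hS] at hkS
    obtain ⟨w, hw, hwk⟩ := mem_image.1 hkS
    obtain ⟨rfl, rfl⟩ := hφ.injective2 hwk
    simp [hw]
  · exact mem_union_left _ (mem_filter.2 ⟨mem_univ _, S, hS, hkS⟩)

open Classical in
theorem exists_tiling_of_multiset [Finite W] [Fintype I] (hr : 0 < r) (hφ : IsBlowUp R D φ)
    (hD : IsOutRainbow c D) {m : Multiset (Finset W × Finset (W × W))}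
    (hm : ∀ K ∈ m, IsTileCopy r R K)
    (hcount : ∀ v, m.countP (fun K => v ∈ K.1) + conflictBound r < Fintype.card I) :
    ∃ T : Finset (Finset V), IsRainbowCliqueTiling c r T ∧ #T = m.card ∧
      (∀ S ∈ T, ∀ u ∈ S, ∃ v k, φ v k = u) ∧
      ∀ v, #{k | ∃ S ∈ T, φ v k ∈ S} ≤ m.countP fun K => v ∈ K.1 := by
  induction m using Multiset.induction_on with
  | empty => exact ⟨∅, ⟨by simp, by simp⟩, by simp, by simp, by simp⟩
  | cons K m ih =>
    have countP_le : ∀ v, m.countP (fun K => v ∈ K.1) ≤ (K ::ₘ m).countP fun K => v ∈ K.1 :=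
      fun v => Multiset.countP_le_of_le _ (Multiset.le_cons_self m K)
    obtain ⟨T, hT, hTcard, hTφ, hTused⟩ := ih (fun K' hK' => hm K' (Multiset.mem_cons_of_mem hK'))
      fun v => (Nat.add_le_add_right (countP_le v) _).trans_lt (hcount v)
    let used (v : W) : Finset I := {k | ∃ S ∈ T, φ v k ∈ S}
    obtain ⟨h, hh_unused, hS⟩ := hφ.exists_isRainbowClique hD (hm K (Multiset.mem_cons_self K m))
      (Y := fun v => (used v)ᶜ) fun v => by
        have h₁ : #(used v) ≤ _ := hTused v
        have h₂ := countP_le v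
        have h₃ := hcount v
        rw [card_compl]
        omega
    set S := K.1.image fun v => φ v (h v) with hSdef
    have hdisj : ∀ S₁ ∈ ({S} : Finset (Finset V)), ∀ S' ∈ T, Disjoint S₁ S' := by
      simp only [mem_singleton, forall_eq, hSdef, disjoint_left, mem_image]
      rintro S' hS' _ ⟨v, -, rfl⟩ hv
      exact mem_compl.1 (hh_unused v) (mem_filter.2 ⟨mem_univ _, S', hS', hv⟩)
    have hS := IsRainbowCliqueTiling.singleton hS
    refine ⟨{S} ∪ T, hS.union hT hdisj, ?_, ?_, fun v => ?_⟩
    · rw [hS.card_union hr hdisj, hTcard, card_singleton, Multiset.card_cons, add_comm]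
    · simp only [mem_union, mem_singleton]
      rintro S' (rfl | hS') u hu
      · obtain ⟨v, -, rfl⟩ := mem_image.1 hu
        exact ⟨v, h v, rfl⟩
      · exact hTφ S' hS' u hu
    · rw [Multiset.countP_cons]
      refine (card_le_card (hφ.used_union_subset h T v)).trans ((card_union_le _ _).trans ?_)
      exact add_le_add (hTused v) (by split_ifs <;> simp)

end IsBlowUp

theorem exists_multiset_of_weight {α : Type*} (s : Finset α) {ω : α → ℝ}
    (hω : ∀ a ∈ s, 0 ≤ ω a) (B : ℕ) :
    ∃ m : Multiset α, (∀ a ∈ m, a ∈ s) ∧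
      (∀ (p : α → Prop) [DecidablePred p], (m.countP p : ℝ) ≤ B * ∑ a ∈ s with p a, ω a) ∧
      B * ∑ a ∈ s, ω a ≤ m.card + #s := by
  refine ⟨∑ a ∈ s, Multiset.replicate ⌊B * ω a⌋₊ a, fun a ha => ?_, fun p _ => ?_, ?_⟩
  · obtain ⟨b, hb, hab⟩ := Multiset.mem_sum.1 ha
    rwa [Multiset.eq_of_mem_replicate hab]
  · rw [← Multiset.coe_countPAddMonoidHom, map_sum]
    simp only [Multiset.coe_countPAddMonoidHom, ← Multiset.coe_replicate, Multiset.coe_countP,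
      List.countP_replicate, decide_eq_true_eq, ← sum_filter]
    rw [Nat.cast_sum, mul_sum]
    exact sum_le_sum fun a ha =>
      Nat.floor_le (mul_nonneg (Nat.cast_nonneg _) (hω a (mem_filter.1 ha).1))
  · rw [Multiset.card_sum, mul_sum, card_eq_sum_ones, ← Nat.cast_add, ← sum_add_distrib,
      Nat.cast_sum]
    refine sum_le_sum fun a _ => ?_
    rw [Multiset.card_replicate, Nat.cast_succ]
    exact (Nat.lt_floor_add_one _).le

section Weights

variable {W : Type*} {r : ℕ} {R R' : Digraph W}

theorem IsTileCopy.of_disjoint {F : Finset W} (hRR' : ∀ v w, v ∉ F → R'.Adj v w → R.Adj v w)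
    {K : Finset W × Finset (W × W)} (hK : IsTileCopy r R' K) (hF : Disjoint K.1 F) :
    IsTileCopy r R K where
  __ := hK
  arcs_adj a ha :=
    hRR' _ _ (disjoint_left.1 hF (hK.arcs_mem a ha).1) (hK.arcs_adj a ha)

variable [Fintype W]

theorem mem_tileCopies {K : Finset W × Finset (W × W)} : K ∈ tileCopies r R ↔ IsTileCopy r R K := by
  simp [tileCopies]

open Classical in
theorem sum_tileWeightAt (ω : Finset W × Finset (W × W) → ℝ) (F : Finset W) :
    ∑ v ∈ F, tileWeightAt r R ω v = ∑ K ∈ tileCopies r R, #(F ∩ K.1) * ω K := by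
  simp only [tileWeightAt, sum_filter]
  rw [sum_comm]
  refine sum_congr rfl fun K _ => ?_
  rw [← sum_filter, sum_const, nsmul_eq_mul, filter_mem_eq_inter]

open Classical in
theorem card_le_of_perfect {ω : Finset W × Finset (W × W) → ℝ}
    (hω : ∀ K ∈ tileCopies r R, 0 ≤ ω K) (hperfect : ∀ v, tileWeightAt r R ω v = 1)
    (F : Finset W) :
    (Fintype.card W : ℝ) ≤ r * (∑ K ∈ tileCopies r R with Disjoint F K.1, ω K + #F) := by
  calc (Fintype.card W : ℝ) = ∑ v, tileWeightAt r R ω v := by simp [hperfect]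
    _ = r * ∑ K ∈ tileCopies r R, ω K := by
        rw [sum_tileWeightAt, mul_sum]
        refine sum_congr rfl fun K hK => ?_
        rw [univ_inter, (mem_tileCopies.1 hK).card_verts]
    _ ≤ _ := by
        refine mul_le_mul_of_nonneg_left ?_ (Nat.cast_nonneg r)
        rw [← sum_filter_add_sum_filter_not _ fun K => Disjoint F K.1]
        gcongr
        calc ∑ K ∈ tileCopies r R with ¬ Disjoint F K.1, ω K
            ≤ ∑ K ∈ tileCopies r R with ¬ Disjoint F K.1, #(F ∩ K.1) * ω K := by
              refine sum_le_sum fun K hK => le_mul_of_one_le_left (hω K (mem_filter.1 hK).1) ?_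
              exact_mod_cast card_pos.2 (not_disjoint_iff_nonempty_inter.1 (mem_filter.1 hK).2)
          _ ≤ ∑ K ∈ tileCopies r R, #(F ∩ K.1) * ω K :=
              sum_le_sum_of_subset_of_nonneg (filter_subset _ _) fun K hK _ =>
                mul_nonneg (Nat.cast_nonneg _) (hω K hK)
          _ = #F := by rw [← sum_tileWeightAt]; simp [hperfect]

open Classical in
theorem HasPerfectFractionalTiling.exists_multiset (hR : HasPerfectFractionalTiling r R)
    (F : Finset W) (B : ℕ) :
    ∃ m : Multiset (Finset W × Finset (W × W)),
      (∀ K ∈ m, IsTileCopy r R K ∧ Disjoint K.1 F) ∧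
      (∀ v, m.countP (fun K => v ∈ K.1) ≤ B) ∧
      B * Fintype.card W ≤
        r * (m.card + Fintype.card (Finset W × Finset (W × W)) + B * #F) := by
  obtain ⟨ω, ⟨hω01, -⟩, hperfect⟩ := hR
  have hω : ∀ K ∈ tileCopies r R, 0 ≤ ω K := fun K hK => (hω01 K hK).1
  set 𝒦 : Finset (Finset W × Finset (W × W)) := {K ∈ tileCopies r R | Disjoint F K.1}
  obtain ⟨m, hm, hcount, hcard⟩ :=
    exists_multiset_of_weight 𝒦 (fun K hK => hω K (mem_filter.1 hK).1) B
  refine ⟨m, fun K hK => ?_, fun v => ?_, ?_⟩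
  · obtain ⟨hK, hKF⟩ := mem_filter.1 (hm K hK)
    exact ⟨mem_tileCopies.1 hK, hKF.symm⟩
  · have weight_le : ∑ K ∈ 𝒦 with v ∈ K.1, ω K ≤ 1 := by
      refine (hperfect v).le.trans' <| sum_le_sum_of_subset_of_nonneg (fun K hK => ?_)
        fun K hK _ => hω K (mem_filter.1 hK).1
      obtain ⟨hK𝒦, hv⟩ := mem_filter.1 hK
      exact mem_filter.2 ⟨(mem_filter.1 hK𝒦).1, hv⟩
    have := (hcount fun K => v ∈ K.1).trans
      (mul_le_of_le_one_right (Nat.cast_nonneg B) weight_le)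
    exact_mod_cast this
  · have card_univ : (#𝒦 : ℝ) ≤ Fintype.card (Finset W × Finset (W × W)) :=
      Nat.cast_le.2 (card_le_univ 𝒦)
    have : (B * Fintype.card W : ℝ) ≤
        r * (m.card + Fintype.card (Finset W × Finset (W × W)) + B * #F) := calc
      (B * Fintype.card W : ℝ) ≤ B * (r * (∑ K ∈ 𝒦, ω K + #F)) := by
        gcongr; exact card_le_of_perfect hω hperfect F
      _ = r * (B * ∑ K ∈ 𝒦, ω K + B * #F) := by ring
      _ ≤ _ := by gcongr; linarith
    exact_mod_cast this

end Weights

open Classical in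
theorem IsBlowUp.exists_larger_tiling {V C W I : Type*} [Fintype W] [Fintype I]
    {G : SimpleGraph V} {c : G.EdgeLabeling C} {D : Digraph V} {R R' : Digraph W} {r : ℕ}
    {φ : W → I → V} (hr : 0 < r) (hD : IsOutRainbow c D) (hφ : IsBlowUp R D φ) {F : Finset W}
    (hRR' : ∀ v w, v ∉ F → R'.Adj v w → R.Adj v w) (hR' : HasPerfectFractionalTiling r R')
    {T : Finset (Finset V)} (hT : IsRainbowCliqueTiling c r T) {B : ℕ}
    (hB : B + conflictBound r < Fintype.card I)
    (hlt : r * (#{S ∈ T | ∃ v k, φ v k ∈ S} + Fintype.card (Finset W × Finset (W × W)) + B * #F) <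
      B * Fintype.card W) :
    ∃ T', IsRainbowCliqueTiling c r T' ∧ #T < #T' := by
  obtain ⟨m, hm, hcount, hcard⟩ := hR'.exists_multiset F B
  obtain ⟨T₂, hT₂, hT₂card, hT₂φ, -⟩ := hφ.exists_tiling_of_multiset hr hD
    (fun K hK => (hm K hK).1.of_disjoint hRR' (hm K hK).2)
    fun v => (Nat.add_le_add_right (hcount v) _).trans_lt hB
  set T₁ : Finset (Finset V) := {S ∈ T | ∃ v k, φ v k ∈ S}
  have hT₀ : IsRainbowCliqueTiling c r (T \ T₁) := hT.of_subset sdiff_subset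
  have hdisj : ∀ S ∈ T \ T₁, ∀ S' ∈ T₂, Disjoint S S' := by
    intro S hS S' hS'
    obtain ⟨hST, hST₁⟩ := mem_sdiff.1 hS
    refine disjoint_left.2 fun u hu hu' => hST₁ (mem_filter.2 ⟨hST, ?_⟩)
    obtain ⟨v, k, rfl⟩ := hT₂φ S' hS' u hu'
    exact ⟨v, k, hu⟩
  refine ⟨(T \ T₁) ∪ T₂, hT₀.union hT₂ hdisj, ?_⟩
  have := Nat.lt_of_mul_lt_mul_left (hlt.trans_le hcard)
  have := card_sdiff_add_card_eq_card (show T₁ ⊆ T from filter_subset _ _)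
  rw [hT₀.card_union hr hdisj, hT₂card]
  omega

theorem exists_pairwiseDisjoint_extension {V : Type*} [Fintype V] {r : ℕ} (hr : 0 < r)
    {T : Finset (Finset V)} (hcard : ∀ S ∈ T, #S = r)
    (hdisj : (T : Set (Finset V)).PairwiseDisjoint id) :
    ∃ 𝓑, T ⊆ 𝓑 ∧ (∀ S ∈ 𝓑, #S = r) ∧ (𝓑 : Set (Finset V)).PairwiseDisjoint id ∧
      Fintype.card V < r * #𝓑 + r := by
  classical
  obtain ⟨𝓑, hT𝓑, ⟨h𝓑card, h𝓑disj⟩, hmax⟩ := Finite.exists_le_maximal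
    (p := fun 𝓑 : Finset (Finset V) =>
      (∀ S ∈ 𝓑, #S = r) ∧ (𝓑 : Set (Finset V)).PairwiseDisjoint id) ⟨hcard, hdisj⟩
  refine ⟨𝓑, hT𝓑, h𝓑card, h𝓑disj, ?_⟩
  by_contra! hle
  have card_covered : #(𝓑.biUnion id) = r * #𝓑 := by
    rw [card_biUnion h𝓑disj, mul_comm]
    exact sum_const_nat h𝓑card
  obtain ⟨S, hS, hScard⟩ : ∃ S ⊆ (𝓑.biUnion id)ᶜ, #S = r :=
    exists_subset_card_eq (by rw [card_compl, card_covered]; omega)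
  have disjoint_S : ∀ S' ∈ 𝓑, Disjoint S S' := fun S' hS' =>
    (disjoint_compl_left.mono_left hS).mono_right (subset_biUnion_of_mem id hS')
  have hS𝓑 : S ∈ 𝓑 := by
    refine hmax ⟨?_, ?_⟩ (subset_insert S 𝓑) (mem_insert_self S 𝓑)
    · simpa [hScard] using h𝓑card
    · rw [coe_insert]
      exact h𝓑disj.insert fun S' hS' _ => disjoint_S S' hS'
  rw [(disjoint_self_iff_empty S).1 (disjoint_S S hS𝓑), card_empty] at hScard
  exact hr.ne hScard

open Classical in
theorem outDeg_eq_card {V : Type*} [Fintype V] (D : Digraph V) (v : V) :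
    outDeg D v = #{w | D.Adj v w} := by
  rw [outDeg, Set.ncard_eq_toFinset_card', Set.toFinset_ofPred]

section Sample

variable {V W ι : Type*} {r : ℕ}

/-- The digraph on `W` obtained by sending the vertices of `W` to positions in a system `b` of
blocks of vertices of `D`, the vertex `v` to position `(e v).2` of the block `b (e v).1`, and
keeping the arcs of `D` between different blocks. Arcs inside a block are dropped so that a change
of one block affects only the arcs at that block. -/
def sampleDigraph (e : W → ι × Fin r) (D : Digraph V) (b : ι → Fin r → V) : Digraph W where
  Adj v w := (e v).1 ≠ (e w).1 ∧ D.Adj (b (e v).1 (e v).2) (b (e w).1 (e w).2)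

open Classical in
/-- The number of arcs of `D` from `u` to the entries of a block `s`. -/
noncomputable def outDegIn (D : Digraph V) (u : V) (s : Fin r → V) : ℕ :=
  #{i | D.Adj u (s i)}

open Classical in
/-- The set of vertices of out-degree less than `d`. -/
noncomputable def lowOutDeg [Fintype W] (R : Digraph W) (d : ℝ) : Finset W :=
  {v | (outDeg R v : ℝ) < d}

theorem outDegIn_le (D : Digraph V) (u : V) (s : Fin r → V) : outDegIn D u s ≤ r := by
  classical
  exact (card_le_univ _).trans_eq (Fintype.card_fin r)

open Classical in
theorem sum_outDegIn [Fintype ι] (D : Digraph V) (u : V) (b : ι → Fin r → V) :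
    ∑ j, outDegIn D u (b j) = #{a : ι × Fin r | D.Adj u (b a.1 a.2)} := by
  simp only [outDegIn, card_filter, Fintype.sum_prod_type]

theorem sum_outDegIn_le_outDeg_sampleDigraph [Fintype W] [Fintype ι] {e : W → ι × Fin r}
    (he : Injective e) (hW : Fintype.card ι * r ≤ Fintype.card W + r) (D : Digraph V)
    (b : ι → Fin r → V) (v : W) :
    ∑ j, outDegIn D (b (e v).1 (e v).2) (b j) ≤ outDeg (sampleDigraph e D b) v + 2 * r := by
  classical
  have outNbrs_subset : ({a | D.Adj (b (e v).1 (e v).2) (b a.1 a.2)} : Finset (ι × Fin r)) ⊆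
      ({w | (sampleDigraph e D b).Adj v w} : Finset W).image e ∪
        ({(e v).1} ×ˢ univ ∪ (univ.image e)ᶜ) := by
    rintro a ha
    by_cases hav : a.1 = (e v).1
    · exact mem_union_right _ (mem_union_left _ (mem_product.2 ⟨mem_singleton.2 hav, mem_univ _⟩))
    by_cases hae : a ∈ univ.image e
    · obtain ⟨w, -, rfl⟩ := mem_image.1 hae
      refine mem_union_left _ (mem_image_of_mem e (mem_filter.2 ⟨mem_univ w, ?_⟩))
      exact ⟨Ne.symm hav, (mem_filter.1 ha).2⟩
    · exact mem_union_right _ (mem_union_right _ (mem_compl.2 hae))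
  have card_block : #(({(e v).1} : Finset ι) ×ˢ (univ : Finset (Fin r))) = r := by simp
  have card_unused : #((univ.image e)ᶜ) ≤ r := by
    rw [card_compl, card_image_of_injective _ he, card_univ, Fintype.card_prod, Fintype.card_fin]
    omega
  rw [sum_outDegIn, outDeg_eq_card]
  refine (card_le_card outNbrs_subset).trans ((card_union_le _ _).trans ?_)
  refine add_le_add card_image_le ((card_union_le _ _).trans ?_)
  omega

theorem outDeg_le_sum_outDegIn [Fintype V] [Fintype ι] (D : Digraph V) {b : ι → Fin r → V}
    (hb : Injective2 b) (hV : Fintype.card V ≤ r * Fintype.card ι + r) (u : V) :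
    outDeg D u ≤ ∑ y, outDegIn D u (b y) + r := by
  classical
  have hb' : Injective (uncurry b) := hb.uncurry
  have outNbrs_subset : ({w | D.Adj u w} : Finset V) ⊆
      ({a | D.Adj u (b a.1 a.2)} : Finset (ι × Fin r)).image (uncurry b) ∪
        (univ.image (uncurry b))ᶜ := by
    intro w hw
    by_cases hwb : w ∈ univ.image (uncurry b)
    · obtain ⟨a, -, rfl⟩ := mem_image.1 hwb
      refine mem_union_left _ (mem_image_of_mem (uncurry b) (mem_filter.2 ⟨mem_univ a, ?_⟩))
      exact (mem_filter.1 hw).2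
    · exact mem_union_right _ (mem_compl.2 hwb)
  have card_unused : #((univ.image (uncurry b))ᶜ) ≤ r := by
    rw [card_compl, card_image_of_injective _ hb', card_univ, Fintype.card_prod,
      Fintype.card_fin, mul_comm]
    omega
  rw [sum_outDegIn, outDeg_eq_card]
  exact (card_le_card outNbrs_subset).trans ((card_union_le _ _).trans
    (add_le_add card_image_le card_unused))

/-- How much the number of arcs from the `i`-th entry of the block `z` into the block `y` falls
short of its mean over all blocks `y`. -/
noncomputable def outDegDeficit {β : Type*} [Fintype β] (D : Digraph V) (b : β → Fin r → V)
    (i : Fin r) (z y : β) : ℝ :=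
  𝔼 y', (outDegIn D (b z i) (b y') : ℝ) - outDegIn D (b z i) (b y)

variable {β : Type*} [Fintype β]

theorem expect_outDegDeficit [Nonempty β] (D : Digraph V) (b : β → Fin r → V) (i : Fin r) (z : β) :
    𝔼 y, outDegDeficit D b i z y = 0 := by
  simp only [outDegDeficit, expect_sub_distrib, Fintype.expect_const, sub_self]

theorem abs_outDegDeficit_le [Nonempty β] (D : Digraph V) (b : β → Fin r → V) (i : Fin r)
    (z y : β) : |outDegDeficit D b i z y| ≤ r := by
  have outDegIn_le : ∀ y, (outDegIn D (b z i) (b y) : ℝ) ≤ r := fun y =>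
    Nat.cast_le.2 (outDegIn_le _ _ _)
  refine abs_sub_le_of_nonneg_of_le ?_ ?_ (Nat.cast_nonneg _) (outDegIn_le y)
  · exact expect_nonneg fun _ _ => Nat.cast_nonneg _
  · exact expect_le univ_nonempty fun y _ => outDegIn_le y

section LowOutDeg

variable [Fintype V] [Fintype W] [Fintype ι] {D : Digraph V} {b : β → Fin r → V}
  {e : W → ι × Fin r} {δ γ : ℝ}

theorem le_sum_outDegDeficit (hb : Injective2 b)
    (hV : Fintype.card V ≤ r * Fintype.card β + r) (he : Injective e)
    (hW : Fintype.card ι * r ≤ Fintype.card W + r) (hγ : 0 ≤ γ)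
    (hD : ∀ u, (δ + 2 * γ) * Fintype.card V ≤ outDeg D u)
    (hlarge : 2 * r + 1 ≤ γ * Fintype.card W) (hβ : Fintype.card ι * r ≤ Fintype.card β)
    {x : ι → β} {v : W} (hv : v ∈ lowOutDeg (sampleDigraph e D (b ∘ x)) (δ * Fintype.card W)) :
    γ * Fintype.card W ≤ ∑ j, outDegDeficit D b (e v).2 (x (e v).1) (x j) := by
  have : Nonempty β := ⟨x (e v).1⟩
  set u := b (x (e v).1) (e v).2
  set μ := 𝔼 y, (outDegIn D u (b y) : ℝ)
  have hv : (outDeg (sampleDigraph e D (b ∘ x)) v : ℝ) < δ * Fintype.card W :=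
    (mem_filter.1 hv).2
  have hδ : 0 ≤ δ + 2 * γ := by
    have : 0 < δ := pos_of_mul_pos_left ((Nat.cast_nonneg _).trans_lt hv) (Nat.cast_nonneg _)
    positivity
  have card_W_le : (Fintype.card W : ℝ) ≤ Fintype.card ι * r := by
    simpa using (Nat.cast_le (α := ℝ)).2 (Fintype.card_le_of_injective e he)
  have card_β_le : (Fintype.card β * r : ℝ) ≤ Fintype.card V := by
    simpa using (Nat.cast_le (α := ℝ)).2 (Fintype.card_le_of_injective _ hb.uncurry)
  have hβ : (Fintype.card ι * r : ℝ) ≤ Fintype.card β := mod_cast hβ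
  have sum_sample_le : ∑ j, (outDegIn D u (b (x j)) : ℝ) ≤ δ * Fintype.card W + 2 * r := by
    have := sum_outDegIn_le_outDeg_sampleDigraph he hW D (b ∘ x) v
    have : (∑ j, outDegIn D u (b (x j)) : ℝ) ≤
      outDeg (sampleDigraph e D (b ∘ x)) v + 2 * r := mod_cast this
    linarith
  have le_mean : (δ + 2 * γ) * (Fintype.card β * r) ≤ Fintype.card β * μ + r := by
    have hsum : (Fintype.card β : ℝ) * μ = ∑ y, (outDegIn D u (b y) : ℝ) := by
      simp only [μ, Fintype.card_mul_expect]
    calc (δ + 2 * γ) * (Fintype.card β * r) ≤ (δ + 2 * γ) * Fintype.card V := by gcongr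
      _ ≤ outDeg D u := hD u
      _ ≤ _ := by rw [hsum]; exact mod_cast outDeg_le_sum_outDegIn D hb hV u
  have le_sample_mean : (δ + 2 * γ) * (Fintype.card ι * r) ≤ Fintype.card ι * μ + 1 := by
    have : (0 : ℝ) < Fintype.card β := Nat.cast_pos.2 Fintype.card_pos
    refine le_of_mul_le_mul_right ?_ this
    linarith [mul_le_mul_of_nonneg_left le_mean (Nat.cast_nonneg (α := ℝ) (Fintype.card ι))]
  calc γ * Fintype.card W ≤ (δ + 2 * γ) * Fintype.card W - 1 - (δ * Fintype.card W + 2 * r) := by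
        linarith
    _ ≤ Fintype.card ι * μ - ∑ j, (outDegIn D u (b (x j)) : ℝ) := by
        linarith [mul_le_mul_of_nonneg_left card_W_le hδ]
    _ = ∑ j, outDegDeficit D b (e v).2 (x (e v).1) (x j) := by
        simp [outDegDeficit, u, μ]

theorem expect_card_lowOutDeg_le [DecidableEq ι] [Nonempty β] (hb : Injective2 b)
    (hV : Fintype.card V ≤ r * Fintype.card β + r) (he : Injective e)
    (hW : Fintype.card ι * r ≤ Fintype.card W + r) (hγ : 0 ≤ γ)
    (hD : ∀ u, (δ + 2 * γ) * Fintype.card V ≤ outDeg D u)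
    (hlarge : 2 * r + 1 ≤ γ * Fintype.card W) (hβ : Fintype.card ι * r ≤ Fintype.card β) :
    (𝔼 x : ι → β, (#(lowOutDeg (sampleDigraph e D (b ∘ x)) (δ * Fintype.card W)) : ℝ)) *
      (γ * Fintype.card W) ^ 2 ≤ Fintype.card W * (Fintype.card ι * r ^ 2) := by
  classical
  have card_mul_le : ∀ x : ι → β,
      #(lowOutDeg (sampleDigraph e D (b ∘ x)) (δ * Fintype.card W)) *
        (γ * Fintype.card W) ^ 2 ≤
      ∑ v, (∑ j, outDegDeficit D b (e v).2 (x (e v).1) (x j)) ^ 2 := by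
    intro x
    rw [← nsmul_eq_mul]
    refine (card_nsmul_le_sum _ _ _ fun v hv => ?_).trans
      (sum_le_univ_sum_of_nonneg fun v => sq_nonneg _)
    exact pow_le_pow_left₀ (by positivity)
      (le_sum_outDegDeficit hb hV he hW hγ hD hlarge hβ hv) 2
  calc _ ≤ 𝔼 x : ι → β, ∑ v, (∑ j, outDegDeficit D b (e v).2 (x (e v).1) (x j)) ^ 2 := by
        rw [expect_mul]
        exact expect_le_expect fun x _ => card_mul_le x
    _ = ∑ v, 𝔼 x : ι → β, (∑ j, outDegDeficit D b (e v).2 (x (e v).1) (x j)) ^ 2 :=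
        expect_sum_comm _ _ _
    _ ≤ ∑ _v : W, Fintype.card ι * (r : ℝ) ^ 2 := sum_le_sum fun v _ =>
        expect_sq_sum_le (expect_outDegDeficit D b _) (abs_outDegDeficit_le D b _) _
    _ = _ := by simp

end LowOutDeg

end Sample

theorem card_le_mul_card_filter {α : Type*} [Fintype α] [Nonempty α] {p : α → Prop}
    [DecidablePred p] {X : α → ℝ} {M : ℝ} (hM : ∀ x, X x ≤ M) (hp : ∀ x, ¬ p x → X x ≤ 1)
    (hX : 2 ≤ 𝔼 x, X x) :
    Fintype.card α ≤ M * #{x | p x} := by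
  have sum_le : ∑ x, X x ≤ M * #{x | p x} + Fintype.card α := calc
    ∑ x, X x ≤ ∑ x, ((if p x then M else 0) + 1) := sum_le_sum fun x _ => by
        split_ifs with hx
        · linarith [hM x]
        · linarith [hp x hx]
    _ = M * #{x | p x} + Fintype.card α := by
        rw [sum_add_distrib, ← sum_filter]
        simp [mul_comm]
  have := mul_le_mul_of_nonneg_left hX (Nat.cast_nonneg (α := ℝ) (Fintype.card α))
  rw [Fintype.card_mul_expect] at this
  linarith

section Completion

variable {W : Type*} {R : Digraph W} {F : Finset W}

/-- The digraph obtained from `R` by adding all arcs leaving the vertices of `F`. -/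
def completeOutOf (R : Digraph W) (F : Finset W) : Digraph W where
  Adj v w := v ≠ w ∧ (v ∈ F ∨ R.Adj v w)

theorem digraphLoopless_completeOutOf : DigraphLoopless (completeOutOf R F) :=
  fun _ h => h.1 rfl

theorem le_minOutDeg_completeOutOf [Fintype W] [Nonempty W] (hR : DigraphLoopless R) {d : ℝ}
    (hd : d ≤ Fintype.card W - 1) : d ≤ minOutDeg (completeOutOf R (lowOutDeg R d)) := by
  classical
  obtain ⟨v, hv⟩ := ciInf_mem fun v => outDeg (completeOutOf R (lowOutDeg R d)) v
  rw [minOutDeg, ← hv]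
  change d ≤ (outDeg _ v : ℝ)
  rw [outDeg_eq_card]
  by_cases hlow : v ∈ lowOutDeg R d
  · have outNbrs_eq : ({w | (completeOutOf R (lowOutDeg R d)).Adj v w} : Finset W) =
        univ.erase v := by
      ext; simp [completeOutOf, hlow, eq_comm]
    rwa [outNbrs_eq, card_erase_of_mem (mem_univ v), card_univ, Nat.cast_pred Fintype.card_pos]
  · have outNbrs_subset : ({w | R.Adj v w} : Finset W) ⊆
        ({w | (completeOutOf R (lowOutDeg R d)).Adj v w} : Finset W) := by
      intro w hw
      rw [mem_filter] at hw ⊢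
      exact ⟨hw.1, by rintro rfl; exact hR v hw.2, .inr hw.2⟩
    refine le_trans ?_ (Nat.cast_le.2 (card_le_card outNbrs_subset))
    rw [← outDeg_eq_card]
    exact not_lt.1 fun h => hlow (mem_filter.2 ⟨mem_univ v, h⟩)

end Completion

theorem isBlowUp_of_forall_sampleDigraph_eq {V W β ι κ : Type*} {r : ℕ} {D : Digraph V}
    {b : β → Fin r → V} {e : W → ι × Fin r} (hb : Injective2 b) (he : Injective e) {f : ι → κ → β}
    (hf : Injective2 f) {R : Digraph W}
    (hR : ∀ σ : ι → κ, sampleDigraph e D (b ∘ fun j => f j (σ j)) = R) :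
    IsBlowUp R D fun v k => b (f (e v).1 k) (e v).2 where
  injective2 v w k l h :=
    have hfe := hf (hb h).1
    ⟨he (Prod.ext hfe.1 (hb h).2), hfe.2⟩
  adj {v w} hvw k l := by
    classical
    let σ := update (fun _ => l) (e v).1 k
    rw [← hR σ] at hvw
    simpa [σ, hvw.1.symm] using hvw.2

theorem exists_block_enumeration {V : Type*} {r : ℕ} {𝓑 : Finset (Finset V)}
    (hcard : ∀ S ∈ 𝓑, #S = r)
    (hdisj : (𝓑 : Set (Finset V)).PairwiseDisjoint id) :
    ∃ b : 𝓑 → Fin r → V, Injective2 b ∧ ∀ S i, b S i ∈ S.1 := by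
  let b (S : 𝓑) (i : Fin r) : S.1 := (S.1.equivFinOfCardEq (hcard S S.2)).symm i
  refine ⟨fun S i => b S i, fun S S' i i' h => ?_, fun S i => (b S i).2⟩
  replace h : (b S i : V) = b S' i' := h
  obtain rfl : S = S' :=
    Subtype.ext (hdisj.elim_finset S.2 S'.2 _ (b S i).2 (h ▸ (b S' i').2))
  exact ⟨rfl, (S.1.equivFinOfCardEq (hcard S S.2)).symm.injective (Subtype.ext h)⟩

theorem card_filter_exists_mem_le {V W ι κ : Type*} [Fintype ι] [DecidableEq ι] [Fintype κ] {r : ℕ}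
    {𝓑 T : Finset (Finset V)} (hT : T ⊆ 𝓑) (hdisj : (𝓑 : Set (Finset V)).PairwiseDisjoint id)
    {b : 𝓑 → Fin r → V} (hb : ∀ S i, b S i ∈ S.1) {f : ι → κ → 𝓑} {P : Finset ι}
    (hP : ∀ j ∈ P, ∀ k, (f j k).1 ∉ T) (e : W → ι × Fin r)
    [DecidablePred fun S : Finset V => ∃ v k, b (f (e v).1 k) (e v).2 ∈ S] :
    #{S ∈ T | ∃ v k, b (f (e v).1 k) (e v).2 ∈ S} ≤ #Pᶜ * Fintype.card κ := by
  classical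
  have subset_image : {S ∈ T | ∃ v k, b (f (e v).1 k) (e v).2 ∈ S} ⊆
      (Pᶜ ×ˢ (univ : Finset κ)).image fun a => (f a.1 a.2).1 := by
    intro S hS
    obtain ⟨hST, v, k, hvS⟩ := mem_filter.1 hS
    have hSf : (f (e v).1 k).1 = S :=
      hdisj.elim_finset (f (e v).1 k).2 (hT hST) _ (hb _ _) hvS
    refine mem_image.2 ⟨((e v).1, k), mem_product.2 ⟨mem_compl.2 fun hj => ?_, mem_univ k⟩, hSf⟩
    exact hP _ hj k (hSf ▸ hST)
  refine (card_le_card subset_image).trans (card_image_le.trans_eq ?_)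
  rw [card_product, card_univ]

section LargerTiling

variable {V W C : Type*} [Fintype V] [Fintype W] {G : SimpleGraph V} {c : G.EdgeLabeling C}
  {D : Digraph V} {r : ℕ} {δ γ : ℝ}

open Classical in
theorem card_pow_le_mul_card_good_samples {β ι : Type*} [Fintype β] [Nonempty β] [Fintype ι]
    [DecidableEq ι] {b : β → Fin r → V} {e : W → ι × Fin r} (hb : Injective2 b)
    (hV : Fintype.card V ≤ r * Fintype.card β + r) (he : Injective e)
    (hW : Fintype.card ι * r ≤ Fintype.card W + r) (hγ : 0 < γ)
    (hD : ∀ u, (δ + 2 * γ) * Fintype.card V ≤ outDeg D u)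
    (hlarge : 2 * r + 1 ≤ γ * Fintype.card W) (hβ : Fintype.card ι * r ≤ Fintype.card β)
    {U : Finset β} (hU : 2 + Fintype.card ι * r ^ 2 / (γ ^ 2 * Fintype.card W) ≤
      Fintype.card ι * (#U / Fintype.card β)) :
    (Fintype.card β : ℝ) ^ Fintype.card ι ≤ Fintype.card ι *
      #{x : ι → β | #(lowOutDeg (sampleDigraph e D (b ∘ x)) (δ * Fintype.card W)) + 2 ≤
        #{j | x j ∈ U}} := by
  have card_W_pos : (0 : ℝ) < Fintype.card W :=
    pos_of_mul_pos_right (lt_of_lt_of_le (by positivity) hlarge) hγ.le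
  have expect_low_le : 𝔼 x : ι → β,
      (#(lowOutDeg (sampleDigraph e D (b ∘ x)) (δ * Fintype.card W)) : ℝ) ≤
        Fintype.card ι * r ^ 2 / (γ ^ 2 * Fintype.card W) := by
    rw [le_div_iff₀ (by positivity)]
    refine le_of_mul_le_mul_right ?_ card_W_pos
    linarith [expect_card_lowOutDeg_le hb hV he hW hγ.le hD hlarge hβ]
  have expect_excess : 2 ≤ 𝔼 x : ι → β, ((#{j | x j ∈ U} : ℝ) -
      #(lowOutDeg (sampleDigraph e D (b ∘ x)) (δ * Fintype.card W))) := by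
    rw [expect_sub_distrib, expect_card_filter_mem]
    linarith
  have key := card_le_mul_card_filter (M := Fintype.card ι)
    (p := fun x : ι → β => #(lowOutDeg (sampleDigraph e D (b ∘ x)) (δ * Fintype.card W)) + 2 ≤
        #{j | x j ∈ U}) (fun x => ?_) (fun x hx => ?_) expect_excess
  · simpa only [Fintype.card_fun, Nat.cast_pow] using key
  · have : (#{j | x j ∈ U} : ℝ) ≤ Fintype.card ι := Nat.cast_le.2 (card_le_univ _)
    linarith [Nat.cast_nonneg (α := ℝ)
      #(lowOutDeg (sampleDigraph e D (b ∘ x)) (δ * Fintype.card W))]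
  · have := Nat.cast_le (α := ℝ).2 (Nat.le_of_lt_succ (not_le.1 hx))
    push_cast at this
    linarith

theorem le_card_sub_one_of_mul_card_le_outDeg [Nonempty V]
    (hD : ∀ u, (δ + 2 * γ) * Fintype.card V ≤ outDeg D u) (hlarge : 1 ≤ γ * Fintype.card W) :
    δ * Fintype.card W ≤ Fintype.card W - 1 := by
  classical
  obtain ⟨u⟩ := ‹Nonempty V›
  have outDeg_le : (outDeg D u : ℝ) ≤ Fintype.card V := by
    rw [outDeg_eq_card]
    exact Nat.cast_le.2 (card_le_univ _)
  have card_V_pos : (0 : ℝ) < Fintype.card V := Nat.cast_pos.2 (Fintype.card_pos_iff.2 ⟨u⟩)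
  have hδ : δ + 2 * γ ≤ 1 :=
    le_of_mul_le_mul_right (by linarith [hD u]) card_V_pos
  have := mul_le_mul_of_nonneg_right hδ (Nat.cast_nonneg (α := ℝ) (Fintype.card W))
  linarith

end LargerTiling

theorem exists_larger_tiling_of_forall_sampleDigraph_eq {V W C ι κ : Type*} [Fintype W]
    [Fintype ι] [Fintype κ] {G : SimpleGraph V} {c : G.EdgeLabeling C} {D : Digraph V} {r : ℕ}
    (hr : 0 < r) (hD : IsOutRainbow c D) {T 𝓑 : Finset (Finset V)}
    (hT : IsRainbowCliqueTiling c r T) (hT𝓑 : T ⊆ 𝓑)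
    (hdisj : (𝓑 : Set (Finset V)).PairwiseDisjoint id) {b : 𝓑 → Fin r → V} (hb : Injective2 b)
    (hb𝓑 : ∀ S i, b S i ∈ S.1) {e : W → ι × Fin r} (he : Injective e)
    (hW : Fintype.card ι * r ≤ Fintype.card W + r) {f : ι → κ → 𝓑} (hf : Injective2 f)
    {R : Digraph W} (hR : ∀ σ : ι → κ, sampleDigraph e D (b ∘ fun j => f j (σ j)) = R)
    {P : Finset ι} (hP : ∀ j ∈ P, ∀ k, (f j k).1 ∉ T) {F : Finset W} (hFP : #F + 2 ≤ #P)
    (hR' : HasPerfectFractionalTiling r (completeOutOf R F))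
    (hκ : (Fintype.card ι + 1) * (conflictBound r + 1) + Fintype.card (Finset W × Finset (W × W)) <
      Fintype.card κ) :
    ∃ T', IsRainbowCliqueTiling c r T' ∧ #T < #T' := by
  classical
  have card_met := card_filter_exists_mem_le hT𝓑 hdisj hb𝓑 hP e
  obtain ⟨s, hs⟩ := Nat.exists_eq_add_of_le (card_le_univ P)
  rw [card_compl, hs, Nat.add_sub_cancel_left] at card_met
  set K := Fintype.card (Finset W × Finset (W × W))
  set m := conflictBound r
  obtain ⟨B, hB⟩ : ∃ B, Fintype.card κ = B + (m + 1) :=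
    Nat.exists_eq_add_of_le' (by nlinarith)
  have hBlt : Fintype.card ι * (m + 1) + K < B := by
    rw [hB, add_mul] at hκ
    omega
  have card_W_ge : r * (#F + s + 1) ≤ Fintype.card W := by
    have : r * (#F + s + 2) ≤ Fintype.card ι * r := by
      rw [mul_comm]
      exact Nat.mul_le_mul_right r (by omega)
    linarith
  refine (isBlowUp_of_forall_sampleDigraph_eq hb he hf hR).exists_larger_tiling (B := B)
    (R' := completeOutOf R F) hr hD (fun v w hv hvw => hvw.2.resolve_left hv) hR' hT
    (by rw [hB]; exact Nat.lt_succ_self _) ?_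
  have inner_lt : s * Fintype.card κ + K + B * #F < B * (#F + s + 1) := by
    have : s * (m + 1) ≤ Fintype.card ι * (m + 1) := Nat.mul_le_mul_right _ (by omega)
    rw [hB]
    linarith [hBlt]
  calc _ ≤ r * (s * Fintype.card κ + K + B * #F) := by gcongr
    _ < r * (B * (#F + s + 1)) := Nat.mul_lt_mul_of_pos_left inner_lt hr
    _ = B * (r * (#F + s + 1)) := mul_left_comm _ _ _
    _ ≤ B * Fintype.card W := Nat.mul_le_mul_left B card_W_ge

section UncoveredBlocks

variable {W : Type*} [Fintype W] {Q r : ℕ} {e : W → Fin Q × Fin r} {γ ν : ℝ}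

theorem exists_blowUp_with_few_lowOutDeg (k : ℕ) (he : Injective e)
    (hW : Q * r ≤ Fintype.card W + r) (hγ : 0 < γ) (hlarge : 2 * r + 1 ≤ γ * Fintype.card W)
    (hν : 2 + Q * r ^ 2 / (γ ^ 2 * Fintype.card W) ≤ Q * ν) :
    ∃ N₀ : ℕ, ∀ {V β : Type*} [Fintype V] [Fintype β] {D : Digraph V} {b : β → Fin r → V}
      {δ : ℝ} {U : Finset β}, Injective2 b → Fintype.card V ≤ r * Fintype.card β + r →
      (∀ u, (δ + 2 * γ) * Fintype.card V ≤ outDeg D u) → N₀ ≤ Fintype.card β →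
      ν * Fintype.card β ≤ #U →
      ∃ (R : Digraph W) (P : Finset (Fin Q)) (f : Fin Q → Fin (k + 1) → β), Injective2 f ∧
        (∀ σ : Fin Q → Fin (k + 1), sampleDigraph e D (b ∘ fun j => f j (σ j)) = R) ∧
        (∀ j ∈ P, ∀ i, f j i ∈ U) ∧ #(lowOutDeg R (δ * Fintype.card W)) + 2 ≤ #P := by
  classical
  have hQ : 0 < Q := by
    rw [pos_iff_ne_zero]
    rintro rfl
    norm_num at hν
  have : Nonempty (Digraph W) := ⟨⊥⟩
  obtain ⟨N₀, hN₀⟩ := exists_monochromatic_blowup Q (k + 1) (Digraph W × Finset (Fin Q))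
    (d := 1 / Q) (by positivity)
  refine ⟨max N₀ (Q * r + 1), fun {V β _ _ D b δ U} hb hV hdeg hN hU => ?_⟩
  have card_β_pos : 0 < Fintype.card β :=
    (Nat.succ_pos _).trans_le ((le_max_right _ _).trans hN)
  have : Nonempty β := Fintype.card_pos_iff.1 card_β_pos
  have hQr : Q * r ≤ Fintype.card β := (Nat.le_succ _).trans ((le_max_right _ _).trans hN)
  have hν' : 2 + Q * r ^ 2 / (γ ^ 2 * Fintype.card W) ≤ (Q : ℝ) * (#U / Fintype.card β) :=
    hν.trans <| by gcongr; rwa [le_div_iff₀ (Nat.cast_pos.2 card_β_pos)]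
  have good := card_pow_le_mul_card_good_samples (δ := δ) (U := U) hb hV he (by simpa using hW) hγ
    hdeg hlarge (by simpa using hQr) (by simpa using hν')
  rw [Fintype.card_fin] at good
  obtain ⟨⟨R, P⟩, f, hf, hfRP⟩ := hN₀ β ((le_max_left _ _).trans hN)
    {x | #(lowOutDeg (sampleDigraph e D (b ∘ x)) (δ * Fintype.card W)) + 2 ≤ #{j | x j ∈ U}}
    (fun x => (sampleDigraph e D (b ∘ x), ({j | x j ∈ U} : Finset (Fin Q))))
    (by rw [one_div, inv_mul_le_iff₀ (Nat.cast_pos.2 hQ)]; exact good)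
  have hR (σ : Fin Q → Fin (k + 1)) : sampleDigraph e D (b ∘ fun j => f j (σ j)) = R :=
    congrArg Prod.fst (hfRP σ).2
  have hP (σ : Fin Q → Fin (k + 1)) : ({j | f j (σ j) ∈ U} : Finset (Fin Q)) = P :=
    congrArg Prod.snd (hfRP σ).2
  refine ⟨R, P, f, hf, hR, fun j hj i => ?_, ?_⟩
  · rw [← hP fun _ => i] at hj
    exact (mem_filter.1 hj).2
  · have := (mem_filter.1 (hfRP fun _ => 0).1).2
    rwa [hR, hP] at this

open Classical in
theorem exists_larger_tiling_of_uncovered_blocks (hr : 0 < r) (he : Injective e)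
    (hW : Q * r ≤ Fintype.card W + r) (hγ : 0 < γ) (hlarge : 2 * r + 1 ≤ γ * Fintype.card W)
    (hν : 2 + Q * r ^ 2 / (γ ^ 2 * Fintype.card W) ≤ Q * ν) :
    ∃ N₀ : ℕ, ∀ {δ : ℝ},
      (∀ R : Digraph W, DigraphLoopless R → δ * Fintype.card W ≤ minOutDeg R →
        HasPerfectFractionalTiling r R) →
      ∀ {V C : Type*} [Fintype V] {G : SimpleGraph V} {c : G.EdgeLabeling C} {D : Digraph V}
        {T 𝓑 : Finset (Finset V)}, IsOutRainbow c D →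
        (∀ u, (δ + 2 * γ) * Fintype.card V ≤ outDeg D u) → IsRainbowCliqueTiling c r T →
        T ⊆ 𝓑 → (∀ S ∈ 𝓑, #S = r) → (𝓑 : Set (Finset V)).PairwiseDisjoint id →
        Fintype.card V ≤ r * #𝓑 + r → N₀ ≤ #𝓑 → ν * #𝓑 ≤ #(𝓑 \ T) →
        ∃ T', IsRainbowCliqueTiling c r T' ∧ #T < #T' := by
  obtain ⟨N₀, hN₀⟩ := exists_blowUp_with_few_lowOutDeg
    ((Q + 1) * (conflictBound r + 1) + Fintype.card (Finset W × Finset (W × W)))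
    he hW hγ hlarge hν
  refine ⟨N₀, fun {δ} hfrac {V C _ G c D T 𝓑} hD hdeg hT hT𝓑 hcard hdisj hV hN hν𝓑 => ?_⟩
  obtain ⟨b, hb, hb𝓑⟩ := exists_block_enumeration hcard hdisj
  let U : Finset 𝓑 := {S | S.1 ∉ T}
  have card_U : #U = #(𝓑 \ T) := by
    rw [← card_map (Embedding.subtype _)]
    congr 1
    ext S
    simp [U, and_comm]
  obtain ⟨R, P, f, hf, hR, hP, hFP⟩ := hN₀ (U := U) hb (by simpa using hV) hdeg
    (by simpa using hN) (by simpa [card_U] using hν𝓑)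
  have : Nonempty W := Fintype.card_pos_iff.1 <| Nat.cast_pos.1 <|
    pos_of_mul_pos_right (lt_of_lt_of_le (by positivity) hlarge) hγ.le
  have : Nonempty V := ‹Nonempty W›.map fun v => b (f (e v).1 0) (e v).2
  have hRloopless : DigraphLoopless R :=
    (isBlowUp_of_forall_sampleDigraph_eq hb he hf hR).digraphLoopless hD.digraphLoopless
  have hR' := hfrac (completeOutOf R (lowOutDeg R (δ * Fintype.card W)))
    digraphLoopless_completeOutOf <| le_minOutDeg_completeOutOf hRloopless <|
      le_card_sub_one_of_mul_card_le_outDeg hdeg (by linarith [Nat.cast_nonneg (α := ℝ) r])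
  exact exists_larger_tiling_of_forall_sampleDigraph_eq hr hD hT hT𝓑 hdisj hb hb𝓑 he
    (by simpa using hW) hf hR (fun j hj i => (mem_filter.1 (hP j hj i)).2) hFP hR' (by simp)

end UncoveredBlocks

theorem half_mul_card_le_card_sdiff {V C : Type*} [Fintype V] [DecidableEq V] {G : SimpleGraph V}
    {c : G.EdgeLabeling C} {r : ℕ} (hr : 0 < r) {T 𝓑 : Finset (Finset V)}
    (hT : IsRainbowCliqueTiling c r T) (hT𝓑 : T ⊆ 𝓑) (hcard : ∀ S ∈ 𝓑, #S = r)
    (hdisj : (𝓑 : Set (Finset V)).PairwiseDisjoint id) (hV : Fintype.card V ≤ r * #𝓑 + r) {η : ℝ}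
    (hη : 0 ≤ η) (hlarge : 2 * r ≤ η * Fintype.card V)
    (hunc : η * Fintype.card V ≤ numUncovered T) : η / 2 * #𝓑 ≤ #(𝓑 \ T) := by
  have card_covered : r * #𝓑 ≤ Fintype.card V := by
    rw [mul_comm, ← sum_const_nat hcard]
    exact (card_biUnion hdisj).symm.trans_le (card_le_univ _)
  have numUncovered_le : numUncovered T ≤ r * #(𝓑 \ T) + r := by
    have := hT.card_add_numUncovered
    rw [← card_sdiff_add_card_eq_card hT𝓑] at hV
    linarith
  have card_covered : (r * #𝓑 : ℝ) ≤ Fintype.card V := mod_cast card_covered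
  have numUncovered_le : (numUncovered T : ℝ) ≤ r * #(𝓑 \ T) + r := mod_cast numUncovered_le
  refine le_of_mul_le_mul_left ?_ (Nat.cast_pos (α := ℝ).2 hr)
  linarith [mul_le_mul_of_nonneg_left card_covered hη]

theorem exists_larger_tiling_of_lt_numUncovered {W : Type*} [Fintype W] {Q r : ℕ} (hr : 0 < r)
    {e : W → Fin Q × Fin r} (he : Injective e) (hW : Q * r ≤ Fintype.card W + r) {γ η : ℝ}
    (hγ : 0 < γ) (hlarge : 2 * r + 1 ≤ γ * Fintype.card W) (hη : 0 < η)
    (hQ : 2 + Q * r ^ 2 / (γ ^ 2 * Fintype.card W) ≤ Q * (η / 2)) :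
    ∃ n₀ : ℕ, ∀ {δ : ℝ},
      (∀ R : Digraph W, DigraphLoopless R → δ * Fintype.card W ≤ minOutDeg R →
        HasPerfectFractionalTiling r R) →
      ∀ {V C : Type*} [Fintype V] {G : SimpleGraph V} {c : G.EdgeLabeling C} {D : Digraph V}
        {T : Finset (Finset V)}, n₀ ≤ Fintype.card V → IsOutRainbow c D →
        (∀ u, (δ + 2 * γ) * Fintype.card V ≤ outDeg D u) → IsRainbowCliqueTiling c r T →
        η * Fintype.card V < numUncovered T →
        ∃ T', IsRainbowCliqueTiling c r T' ∧ #T < #T' := by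
  classical
  obtain ⟨N₀, hN₀⟩ := exists_larger_tiling_of_uncovered_blocks hr he hW hγ hlarge hQ
  obtain ⟨N₁, hN₁⟩ := exists_nat_ge (2 * r / η)
  refine ⟨max N₁ (r * N₀ + r), fun {δ} hfrac {V C _ G c D T} hV hD hdeg hT hunc => ?_⟩
  obtain ⟨𝓑, hT𝓑, hcard, hdisj, hV𝓑⟩ :=
    exists_pairwiseDisjoint_extension hr (fun S hS => (hT.1 S hS).1.card_eq) hT.2
  have hN : N₀ ≤ #𝓑 := by
    have : r * N₀ < r * #𝓑 := by linarith [le_of_max_le_right hV]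
    exact (Nat.lt_of_mul_lt_mul_left this).le
  have hν := half_mul_card_le_card_sdiff hr hT hT𝓑 hcard hdisj hV𝓑.le hη.le
    ((div_le_iff₀' hη).1 (hN₁.trans (Nat.cast_le.2 (le_of_max_le_left hV)))) hunc.le
  exact hN₀ hfrac hD hdeg hT hT𝓑 hcard hdisj hV𝓑.le hN (by convert hν)

theorem two_add_le_div_add_one_mul {r t : ℕ} (hr : 0 < r) (hrt : r ≤ t) {γ η : ℝ} (hγ : 0 < γ)
    (hη : 0 < η) (ht : r * ((2 + 2 * r / γ ^ 2) / η) ≤ t) :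
    2 + (t / r + 1 : ℕ) * r ^ 2 / (γ ^ 2 * t) ≤ (t / r + 1 : ℕ) * η := by
  have hr' : (0 : ℝ) < r := Nat.cast_pos.2 hr
  have ht' : (0 : ℝ) < t := Nat.cast_pos.2 (hr.trans_le hrt)
  have lower : (t : ℝ) ≤ r * (t / r + 1 : ℕ) := mod_cast (Nat.lt_mul_div_succ t hr).le
  have upper : ((t / r + 1 : ℕ) : ℝ) * r ≤ 2 * t := by
    have : (t / r + 1) * r ≤ 2 * t := by
      rw [add_mul, one_mul]
      linarith [Nat.div_mul_le_self t r]
    exact mod_cast this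
  calc _ ≤ 2 + 2 * r / γ ^ 2 := by
        gcongr 2 + ?_
        rw [div_le_div_iff₀ (by positivity) (by positivity)]
        calc _ = (t / r + 1 : ℕ) * (r : ℝ) * (r * γ ^ 2) := by ring
          _ ≤ 2 * t * (r * γ ^ 2) := by gcongr
          _ = _ := by ring
    _ ≤ (t / r + 1 : ℕ) * η := by
        rw [← div_le_iff₀ hη]
        exact le_of_mul_le_mul_left (ht.trans lower) hr'

theorem exists_maximum_tiling {V C : Type*} [Finite V] {G : SimpleGraph V} (c : G.EdgeLabeling C)
    (r : ℕ) : ∃ T, IsRainbowCliqueTiling c r T ∧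
      ∀ T', IsRainbowCliqueTiling c r T' → #T' ≤ #T :=
  Set.exists_max_image {T | IsRainbowCliqueTiling c r T} card (Set.toFinite _)
    ⟨∅, by simp [IsRainbowCliqueTiling]⟩

theorem lemma5p1_general (r : ℕ) (hr : 0 < r) (γ : ℝ) (hγ : 0 < γ) (η : ℝ) (hη : 0 < η) :
    ∃ t₀ : ℕ, ∀ t : ℕ, t₀ ≤ t →
    ∃ n₀ : ℕ, ∀ n : ℕ, n₀ ≤ n →
    ∀ δ : ℝ,
      (∀ R : Digraph (Fin t), DigraphLoopless R → δ * t ≤ (minOutDeg R : ℝ) →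
        HasPerfectFractionalTiling r R) →
    ∀ (V : Type*) [Fintype V] (C : Type*) (G : SimpleGraph V) (c : G.EdgeLabeling C),
      Fintype.card V = n →
      (δ + γ) * n ≤ (minColourDeg c : ℝ) →
      ∃ T : Finset (Finset V), IsRainbowCliqueTiling c r T ∧ (numUncovered T : ℝ) ≤ η * n := by
  obtain ⟨t₀, ht₀⟩ := exists_nat_ge <|
    max ((2 * r + 1) / (γ / 2)) (r * ((2 + 2 * r / (γ / 2) ^ 2) / (η / 2)))
  refine ⟨max r t₀, fun t ht => ?_⟩
  obtain ⟨hlarge, hη_large⟩ := max_le_iff.1 (ht₀.trans (Nat.cast_le.2 (le_of_max_le_right ht)))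
  have hQr : t ≤ (t / r + 1) * r := (Nat.lt_div_mul_add hr).le.trans_eq (by ring)
  obtain ⟨e⟩ : Nonempty (Fin t ↪ Fin (t / r + 1) × Fin r) :=
    Embedding.nonempty_of_card_le (by simpa using hQr)
  obtain ⟨n₀, hn₀⟩ := exists_larger_tiling_of_lt_numUncovered hr e.injective
    (by simpa [add_mul] using Nat.div_mul_le_self t r) (half_pos hγ)
    (by rwa [div_le_iff₀' (by positivity), ← Fintype.card_fin t] at hlarge) hη
    (by simpa using
      two_add_le_div_add_one_mul hr (le_of_max_le_left ht) (half_pos hγ) (half_pos hη) hη_large)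
  refine ⟨n₀, fun n hn δ hfrac V _ C G c hV hdeg => ?_⟩
  subst hV
  obtain ⟨D, hD, hDdeg⟩ := exists_isOutRainbow c
  have hdegD (u : V) : (δ + 2 * (γ / 2)) * Fintype.card V ≤ outDeg D u := by
    rw [mul_div_cancel₀ _ two_ne_zero]
    exact hdeg.trans (Nat.cast_le.2 ((ciInf_le (OrderBot.bddBelow _) u).trans (hDdeg u)))
  obtain ⟨T, hT, hmax⟩ := exists_maximum_tiling c r
  refine ⟨T, hT, not_lt.1 fun hunc => ?_⟩
  obtain ⟨T', hT', hlt⟩ := hn₀ (by simpa using hfrac) hn hD hdegD hT hunc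
  exact (hmax T' hT').not_gt hlt

theorem lemma5p1 (r : ℕ) (hr : 3 ≤ r) (γ : ℝ) (hγ : 0 < γ) :
    ∃ ε₀ : ℝ, 0 < ε₀ ∧ ∀ ε : ℝ, 0 < ε → ε ≤ ε₀ →
    ∃ t₀ : ℕ, ∀ t : ℕ, t₀ ≤ t →
    ∃ n₀ : ℕ, ∀ n : ℕ, n₀ ≤ n →
    ∀ δ : ℝ,
      (∀ R : Digraph (Fin t), DigraphLoopless R → δ * t ≤ (minOutDeg R : ℝ) →
        HasPerfectFractionalTiling r R) →
    ∀ (V : Type*) [Fintype V] (C : Type*) (G : SimpleGraph V) (c : G.EdgeLabeling C),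
      Fintype.card V = n →
      (δ + 3 * γ) * n ≤ (minColourDeg c : ℝ) →
      ∃ T : Finset (Finset V), IsRainbowCliqueTiling c r T ∧
        (numUncovered T : ℝ) ≤ 3 * Real.sqrt ε * n :=
  ⟨1, one_pos, fun ε hε _ =>
    lemma5p1_general r (by omega) (3 * γ) (by positivity) (3 * √ε) (by positivity)⟩
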